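/- Let $A=(Q,q_0,O,R,\sigma)$ be a sequential object with $\sigma:O\times Q\to R\times Q$. Operations $a,b\in O$ *commute in* $q\in Q$ if executing $a$ then $b$ from $q$, and $b$ then $a$ from $q$, gives $a$ the same response, $b$ the same response, and the same final state; they *conflict*, $a\asymp b$, if they do not commute in some $q\in Q$. **Traces.** Let $C=O\times\{1,\dots,n\}\times\mathbb N$ be the set of commands; a command $(op,i,seq)$ acts on states as $op$ does, and commands conflict when their operations do. Two finite sequences (schedules) over $C$ are equivalent if they have the same multiset of elements and every precedence between conflicting occurrences in the first is preserved in the second. A trace is an equivalence class; $\mathrm{ops}(s)$ is its multiset of commands, $\cdot$ is concatenation, $\epsilon$ is the empty trace, and $x\le y$ means $y=x\cdot z$ for some trace $z$. A set of traces is compatible if it has a common upper bound. $\mathsf{ret}^*(cmd,s)$ is the response of (the first occurrence of) $cmd$ when a representative of $s$ is executed from $q_0$. **Generalized commit-adopt (GCA).** A one-shot object with an operation $\mathrm{propose}$. In an execution let $P$ be the set of participants $i$ that propose a trace $s_i$, and $P_r\subseteq P$ those whose call returns, with a pair $(t_i,c_i)$, $t_i$ a trace and $c_i\in\{\mathrm{True},\mathrm{False}\}$.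 It is required that every correct participant returns and that: *(Validity)* $\mathrm{ops}(t_i)\subseteq\bigcup_{j\in P}\mathrm{ops}(s_j)$ as multisets for $i\in P_r$; *(Adoption)* if $c_i=\mathrm{True}$ then $t_i\le t_j$ for all $j\in P_r$; *(Commitment)* if $P=P_r\neq\emptyset$ and $\{s_i:i\in P\}$ is compatible, then $s_j\le t_j$ and $c_j=\mathrm{True}$ for some $j\in P_r$; *(Convergence)* $\{t_i:i\in P_r\}$ is compatible; *(Common prefix)* the greatest lower bound of $\{s_j:j\in P\}$ is $\le t_i$ for all $i\in P_r$; *(Weak agreement)* if all $s_i$, $i\in P$, are equal, then $c_i=\mathrm{True}$ for all $i\in P_r$. **The algorithm.** Processes $1,\dots,n$ run asynchronously, share atomic registers $S[1],\dots,S[n]$, initially $(0,\epsilon)$, and GCA objects $\mathrm{GCA}_1,\mathrm{GCA}_2,\dots$, and may crash. Initially $seq=0$ at each process. To execute an invoked operation $op$, process $i$ does the following: 1. $c\gets\mathrm{False}$; $seq\gets seq+1$; $cmd\gets(op,i,seq)$. 2. Read $S[1],\dots,S[n]$ one by one and let $(r,s)$ be a pair read with the largest round number $r$. 3. While $cmd\notin\mathrm{ops}(s)$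 or $c=\mathrm{False}$: set $r\gets r+1$; if $cmd\notin\mathrm{ops}(s)$, set $s\gets s\cdot cmd$; set $(s,c)\gets\mathrm{GCA}_r.\mathrm{propose}(s)$. 4. $S[i]\gets(r,s)$; return $\mathsf{ret}^*(cmd,s)$. **Progress notions.** In an infinite execution a process is *correct* if it takes infinitely many steps or has no pending operation. An operation instance is *eventually step-contention-free* if it completes or if in some suffix of the execution only this instance takes steps. Two operation instances are concurrent if neither completes before the other is invoked. The execution is *eventually conflict-free* if it has a suffix in which no two distinct concurrent operation instances, with operations $o,o'$, satisfy $o\asymp o'$ (instances that are still pending when the suffix starts are included). **Theorem.** For every sequential object $A$ and every number $n$ of processes, the algorithm is weakly conflict-free, that is: 1. in every infinite execution, every eventually step-contention-free operation instance of a correct process completes; 2. in every infinite execution that is eventually conflict-free, some correct process completes all its operations. Moreover, in (2) the process can be chosen among those that take infinitely many steps. -/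

import Mathlib

namespace ConflictFree

/-! ## Sequential objects, commutativity and conflicts -/

/-- A sequential data type `(Q, q₀, O, R, σ)`. -/
structure SeqObject (Q O R : Type*) where
  /-- the initial state `q₀` -/
  init : Q
  /-- the transition function `σ` -/
  step : O → Q → R × Q

/-- Operations `a` and `b` commute in the state `q`. -/
def SeqObject.CommuteIn {Q O R : Type*} (A : SeqObject Q O R) (a b : O) (q : Q) : Prop :=
  ∃ (ra rb : R) (q₁ q₂ q' : Q),
    A.step a q = (ra, q₁) ∧ A.step b q₁ = (rb, q') ∧
    A.step b q = (rb, q₂) ∧ A.step a q₂ = (ra, q')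

/-- The conflict relation: `a` and `b` fail to commute in some state. -/
def SeqObject.Conflict {Q O R : Type*} (A : SeqObject Q O R) (a b : O) : Prop :=
  ∃ q : Q, ¬ A.CommuteIn a b q

theorem SeqObject.Conflict.symm {Q O R : Type*} {A : SeqObject Q O R} {a b : O}
    (h : A.Conflict a b) : A.Conflict b a := by
  obtain ⟨q, hq⟩ := h
  refine ⟨q, fun ⟨ra, rb, q₁, q₂, q', h1, h2, h3, h4⟩ => hq ⟨rb, ra, q₂, q₁, q', h3, h4, h1, h2⟩⟩

/-- `σ*`: the sequence of responses and states met when a schedule is executed from a state. -/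
def SeqObject.sigmaStar {Q O R : Type*} (A : SeqObject Q O R) : List O → Q → List (R × Q)
  | [], _ => []
  | o :: s, q => A.step o q :: A.sigmaStar s (A.step o q).2

/-! ## Schedules and traces -/

open scoped Classical in
/-- The occurrence number `i` (counted from `0`) of the letter `a` in the schedule `s` is at
position `k` (counted from `0`). -/
def OccursAt {C : Type*} (s : List C) (a : C) (i k : ℕ) : Prop :=
  s[k]? = some a ∧ (s.take k).count a = i

/-- The occurrence number `i` of `a` comes before the occurrence number `j` of `b` in `s`. -/
def OccPrecedes {C : Type*} (s : List C) (a : C) (i : ℕ) (b : C) (j : ℕ) : Prop :=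
  ∃ k l : ℕ, OccursAt s a i k ∧ OccursAt s b j l ∧ k < l

/-- Two schedules are equivalent if they hold the same multiset of operations and every precedence
between conflicting occurrences in the first one is preserved in the second one. -/
def ScheduleEquiv {Q C R : Type*} (A : SeqObject Q C R) (s s' : List C) : Prop :=
  (s : Multiset C) = (s' : Multiset C) ∧
    ∀ (a b : C) (i j : ℕ), A.Conflict a b → OccPrecedes s a i b j → OccPrecedes s' a i b j

section Occurrences

open scoped Classical

variable {C : Type*}

theorem OccursAt.lt_length {s : List C} {a : C} {i k : ℕ} (h : OccursAt s a i k) :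
    k < s.length := by
  obtain ⟨h, -⟩ := h
  exact (List.getElem?_eq_some_iff.1 h).1

theorem OccursAt.count_take_succ {s : List C} {a : C} {i k : ℕ} (h : OccursAt s a i k) :
    (s.take (k + 1)).count a = i + 1 := by
  obtain ⟨h1, h2⟩ := h
  rw [List.take_add_one, h1, List.count_append, h2]
  simp

theorem count_take_mono (s : List C) (a : C) {k l : ℕ} (h : k ≤ l) :
    (s.take k).count a ≤ (s.take l).count a :=
  (List.take_sublist_take_left h).count_le a

theorem OccursAt.unique {s : List C} {a : C} {i k l : ℕ} (h : OccursAt s a i k)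
    (h' : OccursAt s a i l) : k = l := by
  rcases lt_trichotomy k l with hl | hl | hl
  · have h1 := count_take_mono s a (Nat.succ_le_of_lt hl)
    rw [Nat.succ_eq_add_one, h.count_take_succ, h'.2] at h1
    omega
  · exact hl
  · have h1 := count_take_mono s a (Nat.succ_le_of_lt hl)
    rw [Nat.succ_eq_add_one, h'.count_take_succ, h.2] at h1
    omega

theorem OccursAt.lt_count {s : List C} {a : C} {i k : ℕ} (h : OccursAt s a i k) :
    i < s.count a := by
  have h1 := (List.take_sublist (k + 1) s).count_le a
  rw [h.count_take_succ] at h1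
  omega

theorem exists_occursAt {s : List C} {a : C} {i : ℕ} (h : i < s.count a) :
    ∃ k, OccursAt s a i k := by
  induction s generalizing i with
  | nil => simp at h
  | cons b s ih =>
    by_cases hb : b = a
    · subst hb
      rcases i with - | i
      · exact ⟨0, by simp [OccursAt]⟩
      · rw [List.count_cons_self] at h
        obtain ⟨k, hk1, hk2⟩ := ih (i := i) (by omega)
        exact ⟨k + 1, by simpa using hk1, by simpa using hk2⟩
    · rw [List.count_cons_of_ne hb] at h
      obtain ⟨k, hk1, hk2⟩ := ih h
      exact ⟨k + 1, by simpa using hk1, by simpa [List.count_cons_of_ne hb] using hk2⟩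

theorem occursAt_append_left {s u : List C} {a : C} {i k : ℕ} (h : k < s.length) :
    OccursAt (s ++ u) a i k ↔ OccursAt s a i k := by
  unfold OccursAt
  rw [List.getElem?_append_left h, List.take_append_of_le_length h.le]

theorem occursAt_append_right {s u : List C} {a : C} {i k : ℕ} :
    OccursAt (s ++ u) a (s.count a + i) (s.length + k) ↔ OccursAt u a i k := by
  unfold OccursAt
  rw [List.getElem?_append_right (by omega), List.take_length_add_append, List.count_append]
  simp

theorem occursAt_append_cases {s u : List C} {a : C} {i k : ℕ} (h : OccursAt (s ++ u) a i k) :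
    (k < s.length ∧ OccursAt s a i k) ∨
      ∃ i' k', i = s.count a + i' ∧ k = s.length + k' ∧ OccursAt u a i' k' := by
  by_cases hk : k < s.length
  · exact Or.inl ⟨hk, (occursAt_append_left hk).1 h⟩
  · obtain ⟨k', rfl⟩ := Nat.exists_eq_add_of_le (not_lt.1 hk)
    have hc : s.count a ≤ i := by
      have h2 := h.2
      rw [List.take_length_add_append, List.count_append] at h2
      omega
    obtain ⟨i', rfl⟩ := Nat.exists_eq_add_of_le hc
    exact Or.inr ⟨i', k', rfl, rfl, occursAt_append_right.1 h⟩

end Occurrences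

section Equivalence

open scoped Classical

variable {Q C R : Type*} {A : SeqObject Q C R}

theorem ScheduleEquiv.count_eq {s s' : List C} (h : ScheduleEquiv A s s') (a : C) :
    s.count a = s'.count a :=
  (Multiset.coe_eq_coe.1 h.1).count_eq a

theorem ScheduleEquiv.refl (s : List C) : ScheduleEquiv A s s :=
  ⟨rfl, fun _ _ _ _ _ h => h⟩

theorem ScheduleEquiv.symm {s s' : List C} (h : ScheduleEquiv A s s') :
    ScheduleEquiv A s' s := by
  refine ⟨h.1.symm, ?_⟩
  rintro a b i j hab ⟨k', l', hk', hl', hlt⟩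
  obtain ⟨k, hk⟩ := exists_occursAt (s := s) (a := a) (i := i) (by
    rw [h.count_eq]; exact hk'.lt_count)
  obtain ⟨l, hl⟩ := exists_occursAt (s := s) (a := b) (i := j) (by
    rw [h.count_eq]; exact hl'.lt_count)
  rcases lt_trichotomy k l with hkl | hkl | hkl
  · exact ⟨k, l, hk, hl, hkl⟩
  · exfalso
    subst hkl
    have hab' : a = b := Option.some.inj (hk.1.symm.trans hl.1)
    subst hab'
    have hij : i = j := hk.2.symm.trans hl.2
    subst hij
    exact hlt.ne (hk'.unique hl')
  · exfalso
    obtain ⟨l'', k'', hl'', hk'', hlt'⟩ := h.2 b a j i hab.symm ⟨l, k, hl, hk, hkl⟩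
    rw [hl''.unique hl', hk''.unique hk'] at hlt'
    omega

theorem ScheduleEquiv.trans {s s' s'' : List C} (h : ScheduleEquiv A s s')
    (h' : ScheduleEquiv A s' s'') : ScheduleEquiv A s s'' :=
  ⟨h.1.trans h'.1, fun a b i j hab hp => h'.2 a b i j hab (h.2 a b i j hab hp)⟩

theorem ScheduleEquiv.append {s s' u u' : List C} (h : ScheduleEquiv A s s')
    (h' : ScheduleEquiv A u u') : ScheduleEquiv A (s ++ u) (s' ++ u') := by
  refine ⟨Multiset.coe_eq_coe.2
    ((Multiset.coe_eq_coe.1 h.1).append (Multiset.coe_eq_coe.1 h'.1)), ?_⟩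
  rintro a b i j hab ⟨k, l, hk, hl, hlt⟩
  rcases occursAt_append_cases hk with ⟨hks, hk1⟩ | ⟨i', k', rfl, rfl, hk1⟩ <;>
    rcases occursAt_append_cases hl with ⟨hls, hl1⟩ | ⟨j', l', rfl, rfl, hl1⟩
  · obtain ⟨k2, l2, hk2, hl2, hlt2⟩ := h.2 a b i j hab ⟨k, l, hk1, hl1, hlt⟩
    exact ⟨k2, l2, (occursAt_append_left hk2.lt_length).2 hk2,
      (occursAt_append_left hl2.lt_length).2 hl2, hlt2⟩
  · obtain ⟨k2, hk2⟩ := exists_occursAt (s := s') (a := a) (i := i) (by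
      rw [← h.count_eq]; exact hk1.lt_count)
    obtain ⟨l2, hl2⟩ := exists_occursAt (s := u') (a := b) (i := j') (by
      rw [← h'.count_eq]; exact hl1.lt_count)
    refine ⟨k2, s'.length + l2, (occursAt_append_left hk2.lt_length).2 hk2, ?_, ?_⟩
    · rw [h.count_eq]
      exact occursAt_append_right.2 hl2
    · have := hk2.lt_length
      omega
  · omega
  · obtain ⟨k2, l2, hk2, hl2, hlt2⟩ := h'.2 a b i' j' hab ⟨k', l', hk1, hl1, by omega⟩
    refine ⟨s'.length + k2, s'.length + l2, ?_, ?_, by omega⟩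
    · rw [h.count_eq]
      exact occursAt_append_right.2 hk2
    · rw [h.count_eq]
      exact occursAt_append_right.2 hl2

end Equivalence

/-- Equivalence of schedules as a setoid. -/
def scheduleSetoid {Q C R : Type*} (A : SeqObject Q C R) : Setoid (List C) where
  r := ScheduleEquiv A
  iseqv := ⟨ScheduleEquiv.refl, ScheduleEquiv.symm, ScheduleEquiv.trans⟩

/-- Traces: equivalence classes of schedules. -/
def Trace {Q C R : Type*} (A : SeqObject Q C R) : Type _ := Quotient (scheduleSetoid A)

namespace Trace

variable {Q C R : Type*} {A : SeqObject Q C R}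

/-- The trace `[s]` of a schedule `s`. -/
def mk (A : SeqObject Q C R) (s : List C) : Trace A := Quotient.mk (scheduleSetoid A) s

/-- Traces form a monoid under concatenation, `[s] * [s'] = [s ++ s']`, with the empty trace as
unit. -/
instance : Monoid (Trace A) where
  mul := Quotient.map₂ (fun s u => s ++ u) (fun _ _ h _ _ h' => ScheduleEquiv.append h h')
  one := mk A []
  mul_assoc := by
    rintro ⟨a⟩ ⟨b⟩ ⟨c⟩
    exact congrArg (mk A) (List.append_assoc a b c)
  one_mul := by
    rintro ⟨a⟩
    rfl
  mul_one := by
    rintro ⟨a⟩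
    exact congrArg (mk A) (List.append_nil a)

theorem mk_mul_mk (s u : List C) : mk A s * mk A u = mk A (s ++ u) := rfl

/-- The multiset of the operations of a trace. -/
def ops (t : Trace A) : Multiset C :=
  Quotient.lift (s := scheduleSetoid A) (fun s : List C => (s : Multiset C)) (fun _ _ h => h.1) t

theorem ops_mk (s : List C) : ops (mk A s) = (s : Multiset C) := rfl

theorem ops_mul (x y : Trace A) : ops (x * y) = ops x + ops y := by
  obtain ⟨a⟩ := x
  obtain ⟨b⟩ := y
  exact (Multiset.coe_add a b).symm

theorem eq_one_of_ops {x : Trace A} (h : ops x = 0) : x = 1 := by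
  obtain ⟨a⟩ := x
  have : a = [] := Multiset.coe_eq_zero a |>.1 h
  subst this
  rfl

/-- The prefix order: `x ≤ y` if `y = x * z` for some trace `z`. -/
instance : PartialOrder (Trace A) where
  le x y := ∃ z, y = x * z
  le_refl x := ⟨1, (mul_one x).symm⟩
  le_trans := by
    rintro x _ _ ⟨u, rfl⟩ ⟨v, rfl⟩
    exact ⟨u * v, mul_assoc x u v⟩
  le_antisymm := by
    rintro x y ⟨u, rfl⟩ ⟨v, hv⟩
    have h : ops x = ops x + ops u + ops v := by rw [← ops_mul, ← ops_mul, ← hv]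
    have hc := congrArg Multiset.card h
    rw [Multiset.card_add, Multiset.card_add] at hc
    have hu : ops u = 0 := Multiset.card_eq_zero.1 (by omega)
    rw [eq_one_of_ops hu, mul_one]

theorem le_def {x y : Trace A} : x ≤ y ↔ ∃ z, y = x * z := Iff.rfl

/-- A set of traces is compatible if its members have a common extension. -/
def Compatible (S : Set (Trace A)) : Prop := ∃ z : Trace A, ∀ x ∈ S, x ≤ z

/-- `IsRet t a v`: the first occurrence of `a` in the trace `t` returns `v` when a representative of
`t` is executed from the initial state (all representatives give the same value). -/
def IsRet (t : Trace A) (a : C) (v : R) : Prop :=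
  ∃ s : List C, mk A s = t ∧
    ∃ k : ℕ, OccursAt s a 0 k ∧ ((A.sigmaStar s A.init)[k]?).map Prod.fst = some v

end Trace

/-! ## Infinite executions and progress conditions -/

/-- What a step shows in the history: an invocation, a response, or nothing. -/
inductive Event (O R : Type*) where
  | inv (o : O)
  | res (v : R)
  | internal

/-- An infinite execution with `n` participants, reduced to what progress conditions refer to: who
takes the step number `τ`, and the invocation or response event that it carries. -/
abbrev InfExec (n : ℕ) (O R : Type*) := ℕ → Fin n × Event O R

/-- An operation instance `(o, i)`, told apart from others by the time of its invocation. -/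
structure OpInstance (n : ℕ) (O : Type*) where
  proc : Fin n
  op : O
  time : ℕ

section Progress

variable {n : ℕ} {Q O R : Type*}

/-- `Φ` is an operation instance of the execution `α`. -/
def IsInstance (α : InfExec n O R) (Φ : OpInstance n O) : Prop :=
  α Φ.time = (Φ.proc, Event.inv Φ.op)

/-- The matching response of `Φ`, i.e. the first response of its caller after the invocation, is
given at time `t`. -/
def RespondsAt (α : InfExec n O R) (Φ : OpInstance n O) (t : ℕ) : Prop :=
  Φ.time < t ∧ (∃ v, α t = (Φ.proc, Event.res v)) ∧
    ∀ u, Φ.time < u → u < t → ∀ v, α u ≠ (Φ.proc, Event.res v)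

/-- `Φ` completes in `α`. -/
def Completes (α : InfExec n O R) (Φ : OpInstance n O) : Prop :=
  ∃ t, RespondsAt α Φ t

/-- All the operation instances of `i` complete in `α`. -/
def CompletesAll (α : InfExec n O R) (i : Fin n) : Prop :=
  ∀ Φ : OpInstance n O, IsInstance α Φ → Φ.proc = i → Completes α Φ

/-- `i` takes infinitely many steps in `α`. -/
def InfinitelyManySteps (α : InfExec n O R) (i : Fin n) : Prop :=
  ∀ N, ∃ τ, N ≤ τ ∧ (α τ).1 = i

/-- `i` is correct: it takes infinitely many steps or has no pending operation. -/
def Correct (α : InfExec n O R) (i : Fin n) : Prop :=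
  InfinitelyManySteps α i ∨ CompletesAll α i

/-- The step number `τ` of `α` is a step of the operation instance `Φ`. -/
def IsStepOf (α : InfExec n O R) (Φ : OpInstance n O) (τ : ℕ) : Prop :=
  (α τ).1 = Φ.proc ∧ Φ.time ≤ τ ∧ ∀ t, RespondsAt α Φ t → τ ≤ t

/-- `Φ` completes, or from some point on only `Φ` takes steps. -/
def EventuallyStepContentionFree (α : InfExec n O R) (Φ : OpInstance n O) : Prop :=
  Completes α Φ ∨ ∃ T, ∀ τ, T ≤ τ → IsStepOf α Φ τ

/-- `Φ` and `Ψ` are concurrent: neither completes before the other is invoked. -/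
def Concurrent (α : InfExec n O R) (Φ Ψ : OpInstance n O) : Prop :=
  (¬ ∃ t, RespondsAt α Φ t ∧ t < Ψ.time) ∧ (¬ ∃ t, RespondsAt α Ψ t ∧ t < Φ.time)

/-- The execution interval of `Φ` meets the suffix of `α` that starts at time `T`. -/
def MeetsSuffix (α : InfExec n O R) (T : ℕ) (Φ : OpInstance n O) : Prop :=
  ¬ ∃ t, RespondsAt α Φ t ∧ t < T

/-- In some suffix of `α` no two concurrent operation instances conflict. Operations that stay
pending, also those of faulty participants, belong to every suffix. -/
def EventuallyConflictFree (A : SeqObject Q O R) (α : InfExec n O R) : Prop :=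
  ∃ T, ∀ Φ Ψ : OpInstance n O, IsInstance α Φ → IsInstance α Ψ → Φ ≠ Ψ →
    MeetsSuffix α T Φ → MeetsSuffix α T Ψ → Concurrent α Φ Ψ → ¬ A.Conflict Φ.op Ψ.op

/-- Weak conflict-freedom of an implementation of the object `A`, given by the set of its infinite
executions. -/
def WeaklyConflictFree (A : SeqObject Q O R) (E : Set (InfExec n O R)) : Prop :=
  (∀ α ∈ E, ∀ Φ : OpInstance n O, IsInstance α Φ → Correct α Φ.proc →
    EventuallyStepContentionFree α Φ → Completes α Φ) ∧
  (∀ α ∈ E, EventuallyConflictFree A α → ∃ i, Correct α i ∧ CompletesAll α i)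

end Progress

/-! ## Generalized commit-adopt -/

/-- The specification of one generalized commit-adopt object in one execution.
`input i s`: participant `i` proposes `s` (so `i ∈ P`); `output i t c`: the call of `i` returns
`(t, c)` (so `i ∈ P_r`); `correct i`: `i` is correct in the execution. -/
structure IsGCA {n : ℕ} {Q C R : Type*} {A : SeqObject Q C R}
    (correct : Fin n → Prop) (input : Fin n → Trace A → Prop)
    (output : Fin n → Trace A → Bool → Prop) : Prop where
  /-- Every correct participant returns. -/
  termination : ∀ i s, correct i → input i s → ∃ t c, output i t c
  /-- The multiset of the operations of an output lies in the union (with maximal multiplicities)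
  of those of the inputs. -/
  validity : ∀ i t c, output i t c → ∀ a : C, ∀ m : ℕ, 0 < m →
    Multiset.replicate m a ≤ t.ops → ∃ j s, input j s ∧ Multiset.replicate m a ≤ s.ops
  /-- A committed trace is extended by every output. -/
  adoption : ∀ i t, output i t true → ∀ j u c, output j u c → t ≤ u
  /-- If the inputs are compatible and all participants (at least one) return, then one of them
  commits an extension of its input. -/
  commitment : (∃ i s, input i s) → Trace.Compatible {s | ∃ i, input i s} →
    (∀ i s, input i s → ∃ t c, output i t c) →
    ∃ j s t, input j s ∧ output j t true ∧ s ≤ t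
  /-- The outputs are compatible. -/
  convergence : Trace.Compatible {t | ∃ i c, output i t c}
  /-- The greatest lower bound of the inputs is a prefix of every output. -/
  commonPrefix : ∀ i t c, output i t c → ∀ g, IsGLB {s | ∃ j, input j s} g → g ≤ t
  /-- If all inputs are equal, every participant that returns commits. -/
  weakAgreement : (∀ i j s u, input i s → input j u → s = u) →
    ∀ i t c, output i t c → c = true

/-! ## The universal construction -/

/-- Commands `(op, i, seq)`. -/
abbrev Cmd (n : ℕ) (O : Type*) := O × Fin n × ℕ

/-- The object on commands derived from `A`: a command acts as its operation. -/
def commandObject {Q O R : Type*} (A : SeqObject Q O R) (n : ℕ) : SeqObject Q (Cmd n O) R where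
  init := A.init
  step c q := A.step c.1 q

section Construction

variable {n : ℕ} {Q O R : Type*}

/-- Control state of one participant. -/
inductive Phase (A : SeqObject Q O R) (n : ℕ) where
  /-- no operation is pending -/
  | idle
  /-- reading the registers `S[1], …, S[n]`; `view j` is the value of `S[j]` once it is read -/
  | collect (o : O) (view : Fin n → Option (ℕ × Trace (commandObject A n)))
  /-- at the guard of the loop, with local variables `r`, `s`, `c` -/
  | loop (o : O) (r : ℕ) (s : Trace (commandObject A n)) (c : Bool)
  /-- inside the call of `propose` on the GCA object number `r` -/
  | calling (o : O) (r : ℕ)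
  /-- `S[i]` is written; about to return -/
  | returning (o : O) (s : Trace (commandObject A n))

/-- A configuration: the registers `S`, and sequence number and control state of everyone. The
state inside the GCA objects is not part of it; these objects are constrained by their
specification. -/
structure Config (A : SeqObject Q O R) (n : ℕ) where
  S : Fin n → ℕ × Trace (commandObject A n)
  seq : Fin n → ℕ
  phase : Fin n → Phase A n

/-- Steps of a participant. -/
inductive Action (A : SeqObject Q O R) (n : ℕ) where
  /-- an operation is invoked -/
  | invoke (o : O)
  /-- atomic read of `S[j]` -/
  | read (j : Fin n)
  /-- local choice of a pair `S[j]` with maximal round among the pairs read -/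
  | select (j : Fin n)
  /-- call of `propose s` on the GCA object number `k` -/
  | propose (k : ℕ) (s : Trace (commandObject A n))
  /-- a step inside the implementation of a GCA object -/
  | work
  /-- the call on the GCA object number `k` returns `(t, c)` -/
  | decide (k : ℕ) (t : Trace (commandObject A n)) (c : Bool)
  /-- atomic write of `S[i]` -/
  | write
  /-- the pending operation returns `v` -/
  | respond (v : R)

/-- The invocation or response event of a step. -/
def Action.event {A : SeqObject Q O R} : Action A n → Event O R
  | .invoke o => .inv o
  | .respond v => .res v
  | _ => .internal

/-- The initial configuration: `S[j] = (0, ε)`, `seq = 0`, no operation pending. -/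
def Config.initial (A : SeqObject Q O R) (n : ℕ) : Config A n where
  S _ := (0, 1)
  seq _ := 0
  phase _ := .idle

/-- The command of `i` for the operation `o`, with the present sequence number of `i`. -/
def Config.cmd {A : SeqObject Q O R} (γ : Config A n) (i : Fin n) (o : O) : Cmd n O :=
  (o, i, γ.seq i)

/-- `γ` with the control state of `i` changed to `p`. -/
def Config.setPhase {A : SeqObject Q O R} (γ : Config A n) (i : Fin n) (p : Phase A n) :
    Config A n :=
  { γ with phase := Function.update γ.phase i p }

open scoped Classical in
/-- The guarded extension: the trace `s`, with the command `x` appended if `s` lacks it. -/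
noncomputable def extend {A : SeqObject Q O R} (s : Trace (commandObject A n)) (x : Cmd n O) :
    Trace (commandObject A n) :=
  if x ∈ s.ops then s else s * Trace.mk _ [x]

/-- `Step i γ a γ'`: the participant `i` takes the step `a` from `γ` to `γ'`, according to

    invoke(op):
      c := False;  seq := seq + 1;  cmd := (op, i, seq)
      (r, s) := pair with maximal round among S[1], …, S[n]
      while cmd ∉ ops(s) or c = False:
        r := r + 1
        if cmd ∉ ops(s): s := s · cmd
        (s, c) := GCA_r.propose(s)
      S[i] := (r, s)
      return ret*(cmd, s)

The registers are read one at a time, in any order. -/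
inductive Step {A : SeqObject Q O R} (i : Fin n) : Config A n → Action A n → Config A n → Prop
  | invoke (γ : Config A n) (o : O) (h : γ.phase i = .idle) :
      Step i γ (.invoke o)
        { γ with
          seq := Function.update γ.seq i (γ.seq i + 1)
          phase := Function.update γ.phase i (.collect o fun _ => none) }
  | read (γ : Config A n) (o : O) (view : Fin n → Option (ℕ × Trace (commandObject A n)))
      (j : Fin n) (h : γ.phase i = .collect o view) (hj : view j = none) :
      Step i γ (.read j)
        (γ.setPhase i (.collect o (Function.update view j (some (γ.S j)))))
  | select (γ : Config A n) (o : O) (val : Fin n → ℕ × Trace (commandObject A n)) (j : Fin n)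
      (h : γ.phase i = .collect o fun k => some (val k)) (hj : ∀ k, (val k).1 ≤ (val j).1) :
      Step i γ (.select j) (γ.setPhase i (.loop o (val j).1 (val j).2 false))
  | propose (γ : Config A n) (o : O) (r : ℕ) (s : Trace (commandObject A n)) (c : Bool)
      (h : γ.phase i = .loop o r s c) (hg : γ.cmd i o ∉ s.ops ∨ c = false) :
      Step i γ (.propose (r + 1) (extend s (γ.cmd i o))) (γ.setPhase i (.calling o (r + 1)))
  | work (γ : Config A n) (o : O) (r : ℕ) (h : γ.phase i = .calling o r) :
      Step i γ .work γ
  | decide (γ : Config A n) (o : O) (r : ℕ) (t : Trace (commandObject A n)) (c : Bool)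
      (h : γ.phase i = .calling o r) :
      Step i γ (.decide r t c) (γ.setPhase i (.loop o r t c))
  | write (γ : Config A n) (o : O) (r : ℕ) (s : Trace (commandObject A n)) (c : Bool)
      (h : γ.phase i = .loop o r s c) (hg : ¬ (γ.cmd i o ∉ s.ops ∨ c = false)) :
      Step i γ .write
        { γ with
          S := Function.update γ.S i (r, s)
          phase := Function.update γ.phase i (.returning o s) }
  | respond (γ : Config A n) (o : O) (s : Trace (commandObject A n)) (v : R)
      (h : γ.phase i = .returning o s) (hv : s.IsRet (γ.cmd i o) v) :
      Step i γ (.respond v) (γ.setPhase i .idle)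

/-- An infinite sequence of configurations and steps. -/
structure Run (A : SeqObject Q O R) (n : ℕ) where
  conf : ℕ → Config A n
  proc : ℕ → Fin n
  act : ℕ → Action A n

/-- What the progress conditions see of a run. -/
def Run.toInfExec {A : SeqObject Q O R} (ρ : Run A n) : InfExec n O R :=
  fun τ => (ρ.proc τ, (ρ.act τ).event)

/-- The inputs of the GCA object number `k` in a run. -/
def Run.input {A : SeqObject Q O R} (ρ : Run A n) (k : ℕ) (i : Fin n)
    (s : Trace (commandObject A n)) : Prop :=
  ∃ τ, ρ.proc τ = i ∧ ρ.act τ = .propose k s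

/-- The outputs of the GCA object number `k` in a run. -/
def Run.output {A : SeqObject Q O R} (ρ : Run A n) (k : ℕ) (i : Fin n)
    (t : Trace (commandObject A n)) (c : Bool) : Prop :=
  ∃ τ, ρ.proc τ = i ∧ ρ.act τ = .decide k t c

/-- `ρ` is an infinite execution of the universal construction: it starts in the initial
configuration, all its steps follow the algorithm, and each of the objects `GCA_k` behaves as a
generalized commit-adopt object. -/
structure Run.IsExecution {A : SeqObject Q O R} (ρ : Run A n) : Prop where
  start : ρ.conf 0 = Config.initial A n
  step : ∀ τ, Step (ρ.proc τ) (ρ.conf τ) (ρ.act τ) (ρ.conf (τ + 1))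
  gca : ∀ k, IsGCA (Correct ρ.toInfExec) (ρ.input k) (ρ.output k)

/-- The infinite executions of the universal construction for the object `A` and `n`
participants. -/
def ucExecutions (A : SeqObject Q O R) (n : ℕ) : Set (InfExec n O R) :=
  {α | ∃ ρ : Run A n, ρ.IsExecution ∧ ρ.toInfExec = α}

end Construction

end ConflictFree

/-! Both progress claims are proved by contradiction from the same source. Call a process stuck if
it takes infinitely many steps but leaves some operation pending. If every process with infinitely
many steps is stuck, then from some round on each of them calls every GCA object with its own
command in its input, gets an answer, and never commits a trace that holds the command. The other
processes have stopped and are absent from late rounds. So in a late round all participants return,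
and if the inputs were compatible, Commitment would yield a participant whose committed output
extends its input and hence contains its command; that participant would leave the loop and return.
Thus the inputs of late rounds are incompatible (`not_compatible_of_stuck`).

This contradicts either progress assumption. If only one instance takes steps in the end, a late
round has at most one input. If the execution is eventually conflict-free, let `w` be the trace
committed in the last committing round before a late round `k`, or the empty trace. Adoption and
Common prefix make every input of round `k` an extension of `w` (`committed_le`). A completed
operation was committed before it returned, so its command lies in `w`; what the inputs hold beyond
`w` are commands of instances that never complete. These are pairwise concurrent and meet every
suffix, hence do not conflict, and `w` followed by all of them in any order is a common upper bound
(`compatible_of_eventuallyConflictFree`).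

Two facts support this. Greatest lower bounds of traces exist (`exists_isGLB`), without which Common
prefix would say nothing. And each process uses each GCA object at most once, because a measure of
its rounds never decreases (`progress_mono`). -/

namespace ConflictFree

/-! ### Trace combinatorics: cancellation, greatest lower bounds, compatibility -/

namespace Trace

section Letters

open scoped Classical

variable {Q C R : Type*} {A : SeqObject Q C R}

theorem mk_surjective : Function.Surjective (mk A) := Quotient.mk_surjective

theorem mk_eq_mk {s u : List C} : mk A s = mk A u ↔ ScheduleEquiv A s u :=
  ⟨fun h => Quotient.exact h, fun h => Quotient.sound h⟩

theorem le_mul_right (x z : Trace A) : x ≤ x * z := ⟨z, rfl⟩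

theorem one_le (x : Trace A) : 1 ≤ x := ⟨x, (one_mul x).symm⟩

theorem ops_le_of_le {x y : Trace A} (h : x ≤ y) : x.ops ≤ y.ops := by
  obtain ⟨z, rfl⟩ := h
  rw [ops_mul]
  exact Multiset.le_add_right _ _

theorem mk_cons (a : C) (s : List C) : mk A (a :: s) = mk A [a] * mk A s := rfl

/-- Prepending `s` shifts occurrence numbers by the counts in `s` and positions by its length; this
is what makes traces left cancellative. -/
theorem occPrecedes_append_right {s u : List C} {a b : C} {i j : ℕ} :
    OccPrecedes (s ++ u) a (s.count a + i) b (s.count b + j) ↔ OccPrecedes u a i b j := by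
  constructor
  · rintro ⟨k, l, hk, hl, hlt⟩
    have hs : s.length ≤ k ∧ s.length ≤ l := by
      constructor <;> by_contra! h
      · have := ((occursAt_append_left h).1 hk).lt_count
        omega
      · have := ((occursAt_append_left h).1 hl).lt_count
        omega
    obtain ⟨k, rfl⟩ := Nat.exists_eq_add_of_le hs.1
    obtain ⟨l, rfl⟩ := Nat.exists_eq_add_of_le hs.2
    exact ⟨k, l, occursAt_append_right.1 hk, occursAt_append_right.1 hl, by omega⟩
  · rintro ⟨k, l, hk, hl, hlt⟩
    exact ⟨_, _, occursAt_append_right.2 hk, occursAt_append_right.2 hl, by omega⟩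

theorem _root_.ConflictFree.ScheduleEquiv.append_left_cancel {p s u : List C}
    (h : ScheduleEquiv A (p ++ s) (p ++ u)) : ScheduleEquiv A s u := by
  refine ⟨Multiset.coe_eq_coe.2 ((List.perm_append_left_iff p).1 (Multiset.coe_eq_coe.1 h.1)), ?_⟩
  intro a b i j hab hp
  exact occPrecedes_append_right.1 (h.2 a b _ _ hab (occPrecedes_append_right.2 hp))

theorem mul_left_cancel {p x y : Trace A} (h : p * x = p * y) : x = y := by
  obtain ⟨p, rfl⟩ := mk_surjective p
  obtain ⟨x, rfl⟩ := mk_surjective x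
  obtain ⟨y, rfl⟩ := mk_surjective y
  exact mk_eq_mk.2 (mk_eq_mk.1 h).append_left_cancel

theorem mul_le_mul_left_iff {p x y : Trace A} : p * x ≤ p * y ↔ x ≤ y := by
  constructor
  · rintro ⟨z, hz⟩
    exact ⟨z, mul_left_cancel (hz.trans (mul_assoc p x z))⟩
  · rintro ⟨z, rfl⟩
    exact ⟨z, (mul_assoc p x z).symm⟩

/-- Permuted schedules without repetitions and without conflicts between distinct members are
equivalent. -/
theorem _root_.ConflictFree.ScheduleEquiv.of_perm {s u : List C} (h : s.Perm u) (hs : s.Nodup)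
    (hc : ∀ a ∈ s, ∀ b ∈ s, a ≠ b → ¬ A.Conflict a b) : ScheduleEquiv A s u := by
  refine ⟨Multiset.coe_eq_coe.2 h, ?_⟩
  rintro a b i j hab ⟨k, l, hk, hl, hlt⟩
  exfalso
  have ha := hk.lt_count
  have hb := hl.lt_count
  by_cases hne : a = b
  · subst hne
    have := List.nodup_iff_count_le_one.1 hs a
    obtain rfl : i = j := by omega
    have := hk.unique hl
    omega
  · exact hc a (List.count_pos_iff.1 (by omega)) b (List.count_pos_iff.1 (by omega)) hne hab

theorem mk_pair_comm {a b : C} (h : ¬ A.Conflict a b) :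
    mk A [a] * mk A [b] = mk A [b] * mk A [a] := by
  by_cases hab : a = b
  · rw [hab]
  · refine mk_eq_mk.2 (ScheduleEquiv.of_perm (List.Perm.swap b a []) (by simpa using hab) ?_)
    intro x hx y hy hxy
    simp only [List.cons_append, List.nil_append, List.mem_cons, List.not_mem_nil, or_false] at hx hy
    rcases hx with rfl | rfl <;> rcases hy with rfl | rfl
    · exact absurd rfl hxy
    · exact h
    · exact fun h' => h h'.symm
    · exact absurd rfl hxy

theorem mk_append_cons_of_not_conflict {a : C} {s u : List C} (h : ∀ c ∈ s, ¬ A.Conflict c a) :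
    mk A (s ++ a :: u) = mk A [a] * mk A (s ++ u) := by
  induction s with
  | nil => rfl
  | cons c s ih =>
    rw [List.cons_append, mk_cons, ih fun c hc => h c (List.mem_cons_of_mem _ hc), ← mul_assoc,
      mk_pair_comm (h c List.mem_cons_self), mul_assoc, List.cons_append, ← mk_cons]

theorem occursAt_zero_append {a : C} {s u : List C} (h : a ∉ s) :
    OccursAt (s ++ a :: u) a 0 s.length := by
  simp [OccursAt, List.count_eq_zero.2 h]

/-- Two distinct letters below the same trace do not conflict, and the one stays below when the
other is removed. -/
theorem letter_le_of_le_letter_mul {a b : C} (hab : a ≠ b) {y : Trace A}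
    (h : mk A [a] ≤ mk A [b] * y) : ¬ A.Conflict b a ∧ mk A [a] ≤ y := by
  obtain ⟨s, rfl⟩ := mk_surjective y
  obtain ⟨z, hz⟩ := h
  obtain ⟨m, rfl⟩ := mk_surjective z
  have he : ScheduleEquiv A (b :: s) (a :: m) := mk_eq_mk.1 hz
  have ha : a ∈ s := by
    have : a ∈ b :: s := (Multiset.coe_eq_coe.1 he.1).mem_iff.2 List.mem_cons_self
    simpa [hab] using this
  -- This splits at the first `a`. A letter before it that conflicts with `a` would also precede it
  -- in `a :: m`, where it stands at position 0. So `a` can be moved to the front.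
  obtain ⟨s₁, s₂, rfl, h₁⟩ := List.eq_append_cons_of_mem ha
  have hnc : ∀ c ∈ b :: s₁, ¬ A.Conflict c a := by
    intro c hc hca
    obtain ⟨k, hk⟩ := exists_occursAt (s := b :: s₁) (a := c) (i := 0) (List.count_pos_iff.2 hc)
    have h₁' : a ∉ b :: s₁ := by simp [hab, h₁]
    obtain ⟨k', l', -, hl', hlt⟩ := he.2 c a 0 0 hca
      ⟨k, _, (occursAt_append_left (u := a :: s₂) hk.lt_length).2 hk, occursAt_zero_append h₁',
        hk.lt_length⟩
    have h0 : OccursAt (a :: m) a 0 0 := by simp [OccursAt]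
    have := hl'.unique h0
    omega
  refine ⟨hnc b List.mem_cons_self, ?_⟩
  rw [mk_append_cons_of_not_conflict fun c hc => hnc c (List.mem_cons_of_mem _ hc)]
  exact le_mul_right _ _

/-- The letter `a` differs from the first letter of `x` and commutes with it, since both can start
`y`; cancel that letter and induct. The exclusion of `a` passes to the rest of `x`, as otherwise `a`
could be moved back to the front. -/
theorem mul_letter_le {a : C} {x y : Trace A} (ha : mk A [a] ≤ y) (hx : x ≤ y)
    (hax : ¬ mk A [a] ≤ x) : x * mk A [a] ≤ y := by
  obtain ⟨s, rfl⟩ := mk_surjective x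
  induction s generalizing y with
  | nil => exact ha
  | cons b s ih =>
    obtain ⟨z, rfl⟩ := hx
    have hab : a ≠ b := by
      rintro rfl
      exact hax (mk_cons a s ▸ le_mul_right _ _)
    rw [mk_cons b s, mul_assoc] at ha ⊢
    obtain ⟨hnc, ha'⟩ := letter_le_of_le_letter_mul hab ha
    rw [mul_assoc, mul_le_mul_left_iff]
    refine ih ha' (le_mul_right _ _) ?_
    rintro ⟨w, hw⟩
    refine hax ⟨mk A [b] * w, ?_⟩
    rw [mk_cons b s, hw, ← mul_assoc, mk_pair_comm hnc, mul_assoc]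

/-- If `v` is not a prefix of `g`, some prefix `p` of both is extended in `v` by a letter that
cannot extend it in `g`. -/
theorem exists_divergence {g v : Trace A} (h : ¬ v ≤ g) :
    ∃ (p g' : Trace A) (a : C), g = p * g' ∧ p * mk A [a] ≤ v ∧ ¬ mk A [a] ≤ g' := by
  obtain ⟨s, rfl⟩ := mk_surjective v
  induction s generalizing g with
  | nil => exact absurd (one_le g) h
  | cons b s ih =>
    by_cases hb : mk A [b] ≤ g
    · obtain ⟨g₁, rfl⟩ := hb
      rw [mk_cons b s, mul_le_mul_left_iff] at h
      obtain ⟨p, g', a, rfl, hp, hg⟩ := ih h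
      refine ⟨mk A [b] * p, g', a, (mul_assoc _ _ _).symm, ?_, hg⟩
      rwa [mk_cons b s, mul_assoc, mul_le_mul_left_iff]
    · exact ⟨1, g, b, (one_mul g).symm, by rw [one_mul, mk_cons b s]; exact le_mul_right _ _, hb⟩

/-- Every nonempty set of traces has a greatest lower bound. -/
theorem exists_isGLB {S : Set (Trace A)} (hS : S.Nonempty) : ∃ g, IsGLB S g := by
  obtain ⟨x, hx⟩ := hS
  -- The candidate is a lower bound with the largest number of letters. A lower bound not below it
  -- would supply a letter by which it could be lengthened.
  have hne : {k | ∃ g ∈ lowerBounds S, Multiset.card g.ops = k}.Nonempty :=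
    ⟨_, 1, fun y _ => one_le y, rfl⟩
  have hbdd : BddAbove {k | ∃ g ∈ lowerBounds S, Multiset.card g.ops = k} := by
    refine ⟨Multiset.card x.ops, ?_⟩
    rintro _ ⟨g, hg, rfl⟩
    exact Multiset.card_le_card (ops_le_of_le (hg hx))
  obtain ⟨g, hg, hgk⟩ := Nat.sSup_mem hne hbdd
  refine ⟨g, hg, fun v hv => ?_⟩
  by_contra hvg
  obtain ⟨p, g', a, rfl, hp, ha⟩ := exists_divergence hvg
  have hlb : p * g' * mk A [a] ∈ lowerBounds S := by
    intro y hy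
    obtain ⟨z, rfl⟩ := (le_mul_right p g').trans (hg hy)
    rw [mul_assoc, mul_le_mul_left_iff]
    exact mul_letter_le (mul_le_mul_left_iff.1 (hp.trans (hv hy)))
      (mul_le_mul_left_iff.1 (hg hy)) ha
  have := le_csSup hbdd ⟨_, hlb, rfl⟩
  rw [← hgk, ops_mul, ops_mk, Multiset.card_add] at this
  simp at this

/-- Extensions of a trace by distinct commands without conflicts are compatible. -/
theorem compatible_of_not_conflict {S : Set (Trace A)} {w : Trace A} (hfin : S.Finite)
    (hw : ∀ s ∈ S, w ≤ s) (hnodup : ∀ s ∈ S, s.ops.Nodup)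
    (hS : ∀ s ∈ S, ∀ u ∈ S, ∀ a ∈ s.ops, ∀ b ∈ u.ops, a ∉ w.ops → b ∉ w.ops → a ≠ b →
      ¬ A.Conflict a b) : Compatible S := by
  -- All commands that occur beyond `w`: in any order, they extend `w` to the upper bound.
  set X : Finset C := (hfin.toFinset.biUnion fun s => s.ops.toFinset).filter (· ∉ w.ops) with hX
  have hmemX : ∀ a, a ∈ X ↔ (∃ s ∈ S, a ∈ s.ops) ∧ a ∉ w.ops := by simp [hX]
  refine ⟨w * mk A X.toList, fun s hs => ?_⟩
  have hnd := hnodup s hs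
  obtain ⟨z, rfl⟩ := hw s hs
  obtain ⟨l, rfl⟩ := mk_surjective z
  rw [mul_le_mul_left_iff]
  rw [ops_mul, ops_mk, Multiset.nodup_add] at hnd
  have hl : ∀ a ∈ l, a ∈ X.toList := fun a ha => by
    rw [Finset.mem_toList, hmemX]
    exact ⟨⟨_, hs, by rw [ops_mul, Multiset.mem_add]; exact Or.inr ha⟩,
      fun haw => Multiset.disjoint_left.1 hnd.2.2 haw ha⟩
  obtain ⟨l', hl', hsub⟩ := List.subperm_of_subset hnd.2.1 hl
  obtain ⟨m, hm⟩ := hsub.exists_perm_append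
  have hm : (l ++ m).Perm X.toList := (hl'.symm.append_right m).trans hm.symm
  refine ⟨mk A m, (mk_eq_mk.2 (ScheduleEquiv.of_perm hm (hm.nodup_iff.2 X.nodup_toList) ?_)).symm⟩
  intro a ha b hb
  rw [hm.mem_iff, Finset.mem_toList, hmemX] at ha hb
  obtain ⟨⟨s, hs, has⟩, haw⟩ := ha
  obtain ⟨⟨u, hu, hbu⟩, hbw⟩ := hb
  exact hS s hs u hu a has b hbu haw hbw

end Letters
end Trace

/-! ### Runs: invariants and one-shot use of the GCA objects -/

section Runs

variable {n : ℕ} {Q O R : Type*} {A : SeqObject Q O R}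

/-! ### Invariants of runs -/

/-- The operation pending in a control state. -/
def Phase.op? : Phase A n → Option O
  | .idle => none
  | .collect o _ => some o
  | .loop o _ _ _ => some o
  | .calling o _ => some o
  | .returning o _ => some o

/-- A measure of the rounds passed through, for the round `R` in the register of the caller; it
counts twice the rounds, so as to tell a call from its return. -/
def Phase.progress (R : ℕ) : Phase A n → ℕ
  | .loop _ r _ _ => 2 * r + 1
  | .calling _ r => 2 * r
  | _ => 2 * R + 1

/-- The measure of progress of the participant `i` in a configuration. -/
def Config.progress (γ : Config A n) (i : Fin n) : ℕ := (γ.phase i).progress (γ.S i).1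

theorem Step.phase_of_ne {i j : Fin n} {γ γ' : Config A n} {a : Action A n} (h : Step i γ a γ')
    (hj : j ≠ i) : γ'.phase j = γ.phase j ∧ γ'.seq j = γ.seq j ∧ γ'.S j = γ.S j := by
  cases h <;> simp [Config.setPhase, hj]

namespace Run

variable {ρ : Run A n}

/-- The pair `(r, s)` is the initial one or an output of the GCA object number `r`. -/
def Origin (ρ : Run A n) (p : ℕ × Trace (commandObject A n)) : Prop :=
  p = (0, 1) ∨ ∃ j c, ρ.output p.1 j p.2 c

/-- At time `τ`, the participant `i` has already received `s` as a committed output. -/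
def CommittedBefore (ρ : Run A n) (τ : ℕ) (i : Fin n) (r : ℕ) (s : Trace (commandObject A n)) :
    Prop :=
  ∃ τ' < τ, ρ.proc τ' = i ∧ ρ.act τ' = .decide r s true

theorem CommittedBefore.mono {τ τ' : ℕ} {i : Fin n} {r : ℕ} {s : Trace (commandObject A n)}
    (h : ρ.CommittedBefore τ i r s) (hτ : τ ≤ τ') : ρ.CommittedBefore τ' i r s := by
  obtain ⟨u, hu, h⟩ := h
  exact ⟨u, hu.trans_le hτ, h⟩

/-- The invariant of the control state of the participant `i` at time `τ`. -/
def PhaseInv (ρ : Run A n) (τ : ℕ) (i : Fin n) : Phase A n → Prop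
  | .idle => True
  | .collect _ view => (∀ j p, view j = some p → ρ.Origin p) ∧
      ∀ p, view i = some p → p = (ρ.conf τ).S i
  | .loop _ r s c => ρ.Origin (r, s) ∧ (c = true → ρ.CommittedBefore τ i r s)
  | .calling _ r => ∃ s, ρ.input r i s
  | .returning o s => (ρ.conf τ).cmd i o ∈ s.ops ∧ ∃ r, ρ.CommittedBefore τ i r s

namespace IsExecution

/-- Registers and control states need a joint induction: reads pass the origin of a register to a
view, writes pass the origin of a loop state to a register. The clause on `view i` persists because
only `i` writes `S[i]`, and never while collecting. -/
theorem invariant (h : ρ.IsExecution) (τ : ℕ) :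
    (∀ i, ρ.Origin ((ρ.conf τ).S i)) ∧ ∀ i, ρ.PhaseInv τ i ((ρ.conf τ).phase i) := by
  induction τ with
  | zero =>
    rw [h.start]
    exact ⟨fun i => Or.inl rfl, fun i => trivial⟩
  | succ τ ih =>
    obtain ⟨ihS, ihP⟩ := ih
    have hst := h.step τ
    have hother : ∀ j, j ≠ ρ.proc τ → ρ.PhaseInv (τ + 1) j ((ρ.conf (τ + 1)).phase j) := by
      intro j hj
      obtain ⟨hp, hq, hS⟩ := hst.phase_of_ne hj
      rw [hp]
      have := ihP j
      revert this
      cases (ρ.conf τ).phase j with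
      | idle => exact id
      | collect o view =>
        rintro ⟨h1, h2⟩
        exact ⟨h1, fun p hp => (h2 p hp).trans hS.symm⟩
      | loop o r s c => exact fun ⟨h1, h2⟩ => ⟨h1, fun hc => (h2 hc).mono τ.le_succ⟩
      | calling o r => exact id
      | returning o s =>
        rintro ⟨h1, r, h2⟩
        refine ⟨?_, r, h2.mono τ.le_succ⟩
        simpa only [Config.cmd, hq] using h1
    have hself := ihP (ρ.proc τ)
    generalize hi : ρ.proc τ = i at *
    generalize ha : ρ.act τ = a at *
    suffices hs : (∀ j, ρ.Origin ((ρ.conf (τ + 1)).S j)) ∧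
        ρ.PhaseInv (τ + 1) i ((ρ.conf (τ + 1)).phase i) by
      refine ⟨hs.1, fun j => ?_⟩
      by_cases hj : j = i
      · exact hj ▸ hs.2
      · exact hother j hj
    generalize hγ : ρ.conf τ = γ at *
    generalize hγ' : ρ.conf (τ + 1) = γ' at *
    cases hst with
    | invoke o hp =>
      refine ⟨ihS, ?_⟩
      simp [PhaseInv]
    | read o view j hp hj =>
      refine ⟨ihS, ?_⟩
      rw [hp] at hself
      simp only [Config.setPhase, Function.update_self, PhaseInv, hγ']
      refine ⟨fun k p hk => ?_, fun p hk => ?_⟩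
      · by_cases hkj : k = j
        · subst hkj
          simp only [Function.update_self, Option.some.injEq] at hk
          exact hk ▸ ihS k
        · rw [Function.update_of_ne hkj] at hk
          exact hself.1 k p hk
      · by_cases hkj : i = j
        · subst hkj
          simp only [Function.update_self, Option.some.injEq] at hk
          exact hk.symm
        · rw [Function.update_of_ne hkj] at hk
          rw [hself.2 p hk, hγ]
    | select o val j hp hj =>
      refine ⟨ihS, ?_⟩
      rw [hp] at hself
      simp only [Config.setPhase, Function.update_self, PhaseInv]
      exact ⟨hself.1 j _ rfl, by simp⟩
    | propose o r s c hp hg =>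
      refine ⟨ihS, ?_⟩
      simp only [Config.setPhase, Function.update_self, PhaseInv]
      exact ⟨_, τ, hi, ha⟩
    | work o r hp =>
      refine ⟨ihS, ?_⟩
      rw [hp] at hself ⊢
      exact hself
    | decide o r t c hp =>
      refine ⟨ihS, ?_⟩
      simp only [Config.setPhase, Function.update_self, PhaseInv]
      refine ⟨Or.inr ⟨i, c, τ, hi, ha⟩, ?_⟩
      rintro rfl
      exact ⟨τ, τ.lt_succ_self, hi, ha⟩
    | write o r s c hp hg =>
      rw [hp] at hself
      simp only [not_or, not_not, Bool.not_eq_false] at hg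
      constructor
      · intro j
        by_cases hj : j = i
        · subst hj
          simpa using hself.1
        · simpa [hj] using ihS j
      · simp only [Function.update_self, PhaseInv, hγ']
        exact ⟨hg.1, r, (hself.2 hg.2).mono τ.le_succ⟩
    | respond o s v hp hv =>
      refine ⟨ihS, ?_⟩
      simp [Config.setPhase, PhaseInv]

theorem origin_of_loop (h : ρ.IsExecution) {τ : ℕ} {i : Fin n} {o : O} {r : ℕ}
    {s : Trace (commandObject A n)} {c : Bool} (hp : (ρ.conf τ).phase i = .loop o r s c) :
    ρ.Origin (r, s) := by
  have := (h.invariant τ).2 i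
  rw [hp] at this
  exact this.1

/-! ### The GCA objects are used once -/

theorem progress_le_succ (h : ρ.IsExecution) (i : Fin n) (τ : ℕ) :
    (ρ.conf τ).progress i ≤ (ρ.conf (τ + 1)).progress i := by
  have hst := h.step τ
  by_cases hi : i = ρ.proc τ
  swap
  · obtain ⟨h1, -, h2⟩ := hst.phase_of_ne hi
    rw [Config.progress, Config.progress, h1, h2]
  have hinv := (h.invariant τ).2 i
  subst hi
  unfold Config.progress
  generalize ρ.conf (τ + 1) = γ' at *
  generalize ρ.act τ = a at *
  cases hst with
  -- The only step where the round could drop: the pairs compared include the caller's own register,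
  -- so the selected round is at least the one stored there.
  | select o val j hp hj =>
    rw [hp] at hinv
    have h1 := hinv.2 _ rfl
    have h2 := hj (ρ.proc τ)
    rw [h1] at h2
    simp only [hp, Config.setPhase, Function.update_self, Phase.progress]
    omega
  | invoke | read | propose | work | decide | write | respond =>
    simp [*, Phase.progress, Config.setPhase]

theorem progress_mono (h : ρ.IsExecution) (i : Fin n) :
    Monotone fun τ => (ρ.conf τ).progress i :=
  monotone_nat_of_le_succ (h.progress_le_succ i)

theorem progress_of_propose (h : ρ.IsExecution) {τ k : ℕ} {s : Trace (commandObject A n)}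
    (ha : ρ.act τ = .propose k s) :
    (ρ.conf τ).progress (ρ.proc τ) + 1 = 2 * k ∧ (ρ.conf (τ + 1)).progress (ρ.proc τ) = 2 * k := by
  have hst := h.step τ
  rw [ha] at hst
  unfold Config.progress
  generalize ρ.conf (τ + 1) = γ' at *
  cases hst with
  | propose o r s c hp hg =>
    rw [hp]
    simp [Phase.progress, Config.setPhase]
    omega

theorem progress_of_decide (h : ρ.IsExecution) {τ k : ℕ} {t : Trace (commandObject A n)} {c : Bool}
    (ha : ρ.act τ = .decide k t c) :
    (ρ.conf τ).progress (ρ.proc τ) = 2 * k ∧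
      (ρ.conf (τ + 1)).progress (ρ.proc τ) = 2 * k + 1 := by
  have hst := h.step τ
  rw [ha] at hst
  unfold Config.progress
  generalize ρ.conf (τ + 1) = γ' at *
  cases hst with
  | decide o r t c hp =>
    rw [hp]
    simp [Phase.progress, Config.setPhase]

/-- A call in round `k` raises the monotone measure from `2 * k - 1` to `2 * k`, which can happen
only once. -/
theorem input_unique (h : ρ.IsExecution) {k : ℕ} {i : Fin n} {s u : Trace (commandObject A n)}
    (hs : ρ.input k i s) (hu : ρ.input k i u) : s = u := by
  obtain ⟨τ, rfl, hs⟩ := hs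
  obtain ⟨τ', hi, hu⟩ := hu
  have h1 := h.progress_of_propose hs
  have h2 := h.progress_of_propose hu
  rw [hi] at h2
  rcases lt_trichotomy τ τ' with hlt | rfl | hlt
  · have := h.progress_mono (ρ.proc τ) (Nat.succ_le_of_lt hlt)
    simp only [Nat.succ_eq_add_one] at this
    omega
  · rw [hs] at hu
    exact (Action.propose.inj hu).2
  · have := h.progress_mono (ρ.proc τ) (Nat.succ_le_of_lt hlt)
    simp only [Nat.succ_eq_add_one] at this
    omega

theorem output_unique (h : ρ.IsExecution) {k : ℕ} {i : Fin n} {t u : Trace (commandObject A n)}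
    {c d : Bool} (ht : ρ.output k i t c) (hu : ρ.output k i u d) : t = u ∧ c = d := by
  obtain ⟨τ, rfl, ht⟩ := ht
  obtain ⟨τ', hi, hu⟩ := hu
  have h1 := h.progress_of_decide ht
  have h2 := h.progress_of_decide hu
  rw [hi] at h2
  rcases lt_trichotomy τ τ' with hlt | rfl | hlt
  · have := h.progress_mono (ρ.proc τ) (Nat.succ_le_of_lt hlt)
    simp only [Nat.succ_eq_add_one] at this
    omega
  · rw [ht] at hu
    exact (Action.decide.inj hu).2
  · have := h.progress_mono (ρ.proc τ) (Nat.succ_le_of_lt hlt)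
    simp only [Nat.succ_eq_add_one] at this
    omega

theorem finite_inputs (h : ρ.IsExecution) (k : ℕ) : {s | ∃ i, ρ.input k i s}.Finite := by
  rw [Set.ofPred_exists]
  exact Set.finite_iUnion fun i =>
    Set.Subsingleton.finite fun _ hs _ hu => h.input_unique hs hu

/-! ### Inputs and outputs of the GCA objects -/

theorem input_of_output (h : ρ.IsExecution) {k : ℕ} {i : Fin n} {t : Trace (commandObject A n)}
    {c : Bool} (ht : ρ.output k i t c) : ∃ s, ρ.input k i s := by
  obtain ⟨τ, rfl, ha⟩ := ht
  have hst := h.step τ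
  have hinv := (h.invariant τ).2 (ρ.proc τ)
  rw [ha] at hst
  generalize ρ.conf (τ + 1) = γ' at *
  cases hst with
  | decide o r t c hp =>
    rw [hp] at hinv
    exact hinv

/-- Every input extends, by the command of its caller, an output of the round before. -/
theorem origin_of_input (h : ρ.IsExecution) {k : ℕ} {i : Fin n} {s : Trace (commandObject A n)}
    (hs : ρ.input k i s) : ∃ (r : ℕ) (s' : Trace (commandObject A n)) (o : O) (τ : ℕ), k = r + 1 ∧
      s = extend s' ((ρ.conf τ).cmd i o) ∧ ((ρ.conf τ).phase i).op? = some o ∧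
      ρ.Origin (r, s') := by
  obtain ⟨τ, rfl, ha⟩ := hs
  have hst := h.step τ
  rw [ha] at hst
  generalize ρ.conf (τ + 1) = γ' at *
  cases hst with
  | propose o r s c hp hg =>
    exact ⟨r, s, o, τ, rfl, rfl, by rw [hp]; rfl, h.origin_of_loop hp⟩

end IsExecution
end Run

/-! ### The guarded extension by a command -/

theorem le_extend (s : Trace (commandObject A n)) (x : Cmd n O) : s ≤ extend s x := by
  unfold extend
  split_ifs
  · exact le_rfl
  · exact Trace.le_mul_right _ _

theorem mem_ops_extend (s : Trace (commandObject A n)) (x : Cmd n O) : x ∈ (extend s x).ops := by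
  unfold extend
  split_ifs with h
  · exact h
  · rw [Trace.ops_mul, Multiset.mem_add]
    exact Or.inr (Multiset.mem_singleton_self x)

theorem mem_of_mem_ops_extend {s : Trace (commandObject A n)} {x y : Cmd n O}
    (h : y ∈ (extend s x).ops) : y ∈ s.ops ∨ y = x := by
  unfold extend at h
  split_ifs at h
  · exact Or.inl h
  · rw [Trace.ops_mul, Multiset.mem_add] at h
    exact h.imp id Multiset.mem_singleton.1

theorem nodup_ops_extend {s : Trace (commandObject A n)} (x : Cmd n O) (h : s.ops.Nodup) :
    (extend s x).ops.Nodup := by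
  unfold extend
  split_ifs with hx
  · exact h
  · rw [Trace.ops_mul, Multiset.nodup_add]
    refine ⟨h, Multiset.nodup_singleton x, ?_⟩
    rw [Multiset.disjoint_left]
    intro a ha hb
    exact hx (Multiset.mem_singleton.1 hb ▸ ha)

/-! ### What traces inherit from earlier rounds -/

namespace Run.IsExecution

variable {ρ : Run A n}

/-- Repetition-freedom, and any property of single commands that is common to all commands
proposed, is inherited by all inputs and outputs. -/
theorem nodup_and_forall_ops (h : ρ.IsExecution) {p : Cmd n O → Prop}
    (hp : ∀ τ i o, ((ρ.conf τ).phase i).op? = some o → p ((ρ.conf τ).cmd i o)) (k : ℕ) :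
    (∀ i s, ρ.input k i s → s.ops.Nodup ∧ ∀ x ∈ s.ops, p x) ∧
      ∀ i t c, ρ.output k i t c → t.ops.Nodup ∧ ∀ x ∈ t.ops, p x := by
  classical
  have hout : ∀ k, (∀ i s, ρ.input k i s → s.ops.Nodup ∧ ∀ x ∈ s.ops, p x) →
      ∀ i t c, ρ.output k i t c → t.ops.Nodup ∧ ∀ x ∈ t.ops, p x := by
    intro k hin i t c ht
    constructor
    · rw [Multiset.nodup_iff_count_le_one]
      intro a
      by_contra! hlt
      -- Validity uses the union with maximal multiplicities, so a command that occurs twice in an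
      -- output occurs twice in a single input.
      obtain ⟨j, s, hs, hle⟩ := (h.gca k).validity i t c ht a 2 two_pos
        (Multiset.le_count_iff_replicate_le.1 hlt)
      have := Multiset.nodup_iff_count_le_one.1 (hin j s hs).1 a
      have := Multiset.le_count_iff_replicate_le.2 hle
      omega
    · intro x hx
      obtain ⟨j, s, hs, hle⟩ := (h.gca k).validity i t c ht x 1 one_pos
        (by simpa using hx)
      exact (hin j s hs).2 x (by simpa using hle)
  induction k with
  | zero =>
    refine (fun hin => ⟨hin, hout 0 hin⟩) ?_
    intro i s hs
    obtain ⟨r, s', o, τ, hr, -⟩ := h.origin_of_input hs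
    omega
  | succ k ih =>
    refine (fun hin => ⟨hin, hout (k + 1) hin⟩) ?_
    intro i s hs
    obtain ⟨r, s', o, τ, hr, rfl, hpo, hor⟩ := h.origin_of_input hs
    obtain rfl : k = r := by omega
    have hs' : s'.ops.Nodup ∧ ∀ x ∈ s'.ops, p x := by
      rcases hor with hor | ⟨j, c, hj⟩
      · obtain rfl : s' = 1 := congrArg Prod.snd hor
        exact ⟨Multiset.nodup_zero, fun x hx => absurd hx (Multiset.notMem_zero x)⟩
      · exact ih.2 j s' c hj
    refine ⟨nodup_ops_extend _ hs'.1, fun x hx => ?_⟩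
    rcases mem_of_mem_ops_extend hx with hx | rfl
    · exact hs'.2 x hx
    · exact hp τ i o hpo

/-- A trace committed in round `r` is a prefix of all outputs of the rounds from `r` on and of all
inputs of the later rounds. -/
theorem committed_le (h : ρ.IsExecution) {r : ℕ} {i : Fin n} {t : Trace (commandObject A n)}
    (ht : ρ.output r i t true) {k : ℕ} (hk : r ≤ k) :
    (∀ j u c, ρ.output k j u c → t ≤ u) ∧ ∀ j s, ρ.input (k + 1) j s → t ≤ s := by
  have hin : ∀ k, r ≤ k → (∀ j u c, ρ.output k j u c → t ≤ u) →
      ∀ j s, ρ.input (k + 1) j s → t ≤ s := by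
    intro k hk hout j s hs
    obtain ⟨r', s', o, τ, hr, rfl, -, hor⟩ := h.origin_of_input hs
    obtain rfl : k = r' := by omega
    refine le_trans ?_ (le_extend _ _)
    rcases hor with hor | ⟨j, c, hj⟩
    · obtain ⟨rfl, rfl⟩ := Prod.mk.inj hor
      obtain rfl : r = 0 := by omega
      -- Rounds start at 1: the object with number 0 has no inputs, hence no outputs.
      obtain ⟨u, hu⟩ := h.input_of_output ht
      obtain ⟨_, _, _, _, h0, -⟩ := h.origin_of_input hu
      omega
    · exact hout j s' c hj
  suffices hout : ∀ j u c, ρ.output k j u c → t ≤ u from ⟨hout, hin k hk hout⟩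
  induction k, hk using Nat.le_induction with
  | base => exact (h.gca r).adoption i t ht
  | succ k hk ih =>
    intro j u c hu
    obtain ⟨s, hs⟩ := h.input_of_output hu
    -- `t` is a lower bound of the inputs, so it lies below `g`, which Common prefix puts below
    -- every output.
    obtain ⟨g, hg⟩ := Trace.exists_isGLB (S := {s | ∃ j, ρ.input (k + 1) j s}) ⟨s, j, hs⟩
    refine le_trans (hg.2 ?_) ((h.gca (k + 1)).commonPrefix j u c hu g hg)
    rintro s ⟨j, hs⟩
    exact hin k hk ih j s hs

end Run.IsExecution

end Runs

/-! ### Operation instances and the rounds of stuck processes -/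

section Instances

variable {n : ℕ} {Q O R : Type*} {A : SeqObject Q O R}

theorem Action.eq_invoke {a : Action A n} {o : O} (h : a.event = .inv o) : a = .invoke o := by
  cases a <;> simp_all [Action.event]

theorem Action.eq_respond {a : Action A n} {v : R} (h : a.event = .res v) : a = .respond v := by
  cases a <;> simp_all [Action.event]

theorem exists_first_response {α : InfExec n O R} {Φ : OpInstance n O} {t : ℕ} {v : R}
    (ht : Φ.time < t) (hv : α t = (Φ.proc, .res v)) : Completes α Φ := by
  classical
  have hex : ∃ t, Φ.time < t ∧ ∃ v, α t = (Φ.proc, Event.res v) := ⟨t, ht, v, hv⟩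
  refine ⟨Nat.find hex, (Nat.find_spec hex).1, (Nat.find_spec hex).2, fun u hu hlt v hv => ?_⟩
  exact Nat.find_min hex hlt ⟨hu, v, hv⟩

namespace Run

variable {ρ : Run A n}

/-- The command of an operation instance of a run. -/
def cmdOf (ρ : Run A n) (Φ : OpInstance n O) : Cmd n O :=
  (ρ.conf (Φ.time + 1)).cmd Φ.proc Φ.op

namespace IsExecution

/-! ### Pending operation instances -/

theorem phase_of_isInstance (h : ρ.IsExecution) {Φ : OpInstance n O}
    (hΦ : IsInstance ρ.toInfExec Φ) :
    (ρ.conf (Φ.time + 1)).phase Φ.proc = .collect Φ.op fun _ => none := by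
  obtain ⟨hp, ha⟩ := Prod.mk.inj hΦ
  have hst := h.step Φ.time
  rw [Action.eq_invoke ha, hp] at hst
  generalize ρ.conf (Φ.time + 1) = γ' at *
  cases hst
  simp

/-- Only an invocation changes the sequence number, and it needs an idle caller; only a response
makes the caller idle. -/
theorem op_of_pending (h : ρ.IsExecution) {Φ : OpInstance n O}
    (hΦ : IsInstance ρ.toInfExec Φ) {τ : ℕ} (hτ : Φ.time < τ)
    (hres : ∀ u, Φ.time < u → u < τ → ∀ v, ρ.toInfExec u ≠ (Φ.proc, .res v)) :
    ((ρ.conf τ).phase Φ.proc).op? = some Φ.op ∧ (ρ.conf τ).cmd Φ.proc Φ.op = ρ.cmdOf Φ := by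
  induction τ, Nat.succ_le_of_lt hτ using Nat.le_induction with
  | base => exact ⟨by rw [Nat.succ_eq_add_one, h.phase_of_isInstance hΦ]; rfl, rfl⟩
  | succ τ hle ih =>
    obtain ⟨ih1, ih2⟩ := ih (Nat.lt_of_succ_le hle) fun u hu hlt => hres u hu (by omega)
    have hr := hres τ hle τ.lt_succ_self
    have hst := h.step τ
    by_cases hi : Φ.proc = ρ.proc τ
    swap
    · obtain ⟨h1, h2, -⟩ := hst.phase_of_ne hi
      rw [h1, ← ih2, Config.cmd, Config.cmd, h2]
      exact ⟨ih1, rfl⟩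
    rw [← ih2]
    unfold toInfExec at hr
    rw [← hi] at hst hr
    generalize ρ.conf (τ + 1) = γ' at *
    generalize ρ.act τ = a at *
    cases hst with
    | invoke o hp => simp [hp, Phase.op?] at ih1
    | respond o s v hp hv => exact absurd rfl (hr v)
    | read o view j hp => simpa [hp, Config.setPhase, Config.cmd, Phase.op?] using ih1
    | select o val j hp => simpa [hp, Config.setPhase, Config.cmd, Phase.op?] using ih1
    | propose o r s c hp => simpa [hp, Config.setPhase, Config.cmd, Phase.op?] using ih1
    | work o r hp => exact ⟨ih1, rfl⟩
    | decide o r t c hp => simpa [hp, Config.setPhase, Config.cmd, Phase.op?] using ih1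
    | write o r s c hp => simpa [hp, Config.setPhase, Config.cmd, Phase.op?] using ih1

theorem exists_instance (h : ρ.IsExecution) {τ : ℕ} {i : Fin n} {o : O}
    (ho : ((ρ.conf τ).phase i).op? = some o) :
    ∃ Φ : OpInstance n O, IsInstance ρ.toInfExec Φ ∧ Φ.proc = i ∧ Φ.op = o ∧ Φ.time < τ ∧
      ∀ u, Φ.time < u → u < τ → ∀ v, ρ.toInfExec u ≠ (Φ.proc, .res v) := by
  induction τ with
  | zero =>
    rw [h.start] at ho
    cases ho
  | succ τ ih =>
    have hst := h.step τ
    -- Going back one step: the first case is refuted below, since a response leaves the caller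
    -- idle; the second is the induction hypothesis; the third is the invocation sought.
    have hkey : (∃ v, ρ.toInfExec τ = (i, .res v)) ∨ ((ρ.conf τ).phase i).op? = some o ∧
        (∀ v, ρ.toInfExec τ ≠ (i, .res v)) ∨ IsInstance ρ.toInfExec ⟨i, o, τ⟩ := by
      by_cases hi : i = ρ.proc τ
      swap
      · rw [(hst.phase_of_ne hi).1] at ho
        exact Or.inr (Or.inl ⟨ho, fun v hv => hi (congrArg Prod.fst hv).symm⟩)
      subst hi
      rw [IsInstance]
      unfold toInfExec
      generalize ρ.conf (τ + 1) = γ' at *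
      generalize ρ.act τ = a at *
      cases hst with
      | invoke o' hp =>
        simp only [Function.update_self, Phase.op?, Option.some.injEq] at ho
        subst ho
        exact Or.inr (Or.inr rfl)
      | respond o s v hp hv => exact Or.inl ⟨v, rfl⟩
      | read | select | propose | work | decide | write =>
        refine Or.inr (Or.inl ⟨?_, fun v hv => by cases hv⟩)
        simpa [*, Config.setPhase, Phase.op?] using ho
    rcases hkey with ⟨v, hv⟩ | ⟨ho, hv⟩ | hinst
    · obtain ⟨hi, ha⟩ := Prod.mk.inj hv
      rw [hi, Action.eq_respond ha] at hst
      generalize ρ.conf (τ + 1) = γ' at *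
      cases hst
      simp [Config.setPhase, Phase.op?] at ho
    · obtain ⟨Φ, h1, h2, h3, h4, h5⟩ := ih ho
      refine ⟨Φ, h1, h2, h3, h4.trans τ.lt_succ_self, fun u hu hlt => ?_⟩
      rcases Nat.lt_succ_iff_lt_or_eq.1 hlt with hlt | rfl
      · exact h5 u hu hlt
      · rw [h2]
        exact hv
    · exact ⟨_, hinst, rfl, rfl, τ.lt_succ_self, fun u hu hlt => by
        have : τ < u := hu
        omega⟩

/-- The commands in the inputs are those of operation instances. -/
theorem exists_cmdOf_eq (h : ρ.IsExecution) {k : ℕ} {i : Fin n} {s : Trace (commandObject A n)}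
    (hs : ρ.input k i s) : s.ops.Nodup ∧
      ∀ x ∈ s.ops, ∃ Φ, IsInstance ρ.toInfExec Φ ∧ ρ.cmdOf Φ = x := by
  refine (h.nodup_and_forall_ops (fun τ i o ho => ?_) k).1 i s hs
  obtain ⟨Φ, h1, rfl, rfl, h4, h5⟩ := h.exists_instance ho
  exact ⟨Φ, h1, (h.op_of_pending h1 h4 h5).2.symm⟩

/-- The command of a completed instance belongs to a trace committed before. -/
theorem exists_committed_of_respondsAt (h : ρ.IsExecution) {Φ : OpInstance n O}
    (hΦ : IsInstance ρ.toInfExec Φ) {t : ℕ} (ht : RespondsAt ρ.toInfExec Φ t) :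
    ∃ r s, ρ.cmdOf Φ ∈ s.ops ∧ ρ.CommittedBefore t Φ.proc r s := by
  obtain ⟨hlt, ⟨v, hv⟩, hmin⟩ := ht
  obtain ⟨ho, hc⟩ := h.op_of_pending hΦ hlt hmin
  have hinv := (h.invariant t).2 Φ.proc
  have hst := h.step t
  obtain ⟨hi, ha⟩ := Prod.mk.inj hv
  rw [hi, Action.eq_respond ha] at hst
  generalize ρ.conf (t + 1) = γ' at *
  cases hst with
  | respond o s v hp hv =>
    rw [hp] at ho hinv
    obtain ⟨hm, r, hr⟩ := hinv
    obtain rfl : o = Φ.op := Option.some.inj ho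
    exact ⟨r, s, hc ▸ hm, hr⟩

/-! ### Participants that take infinitely many steps -/

/-- Other participants do not touch the control state of `i`, so its next own step finds that state
unchanged. -/
theorem exists_next_step (h : ρ.IsExecution) {i : Fin n}
    (hi : InfinitelyManySteps ρ.toInfExec i) (τ : ℕ) :
    ∃ τ' ≥ τ, ρ.proc τ' = i ∧ (ρ.conf τ').phase i = (ρ.conf τ).phase i := by
  classical
  have hex : ∃ d, ρ.proc (τ + d) = i := by
    obtain ⟨τ', hle, hp⟩ := hi τ
    obtain ⟨d, rfl⟩ := Nat.exists_eq_add_of_le hle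
    exact ⟨d, hp⟩
  refine ⟨τ + Nat.find hex, Nat.le_add_right _ _, Nat.find_spec hex, ?_⟩
  have : ∀ d ≤ Nat.find hex, (ρ.conf (τ + d)).phase i = (ρ.conf τ).phase i := by
    intro d
    induction d with
    | zero => exact fun _ => rfl
    | succ d ih =>
      intro hd
      have hne : i ≠ ρ.proc (τ + d) := fun he => Nat.find_min hex hd he.symm
      rw [← ih (by omega)]
      exact ((h.step (τ + d)).phase_of_ne hne).1
  exact this _ le_rfl

/-- A call made by a participant with infinitely many steps returns. -/
theorem exists_output_of_calling (h : ρ.IsExecution) {i : Fin n}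
    (hi : InfinitelyManySteps ρ.toInfExec i) {τ : ℕ} {o : O} {k : ℕ}
    (hp : (ρ.conf τ).phase i = .calling o k) :
    ∃ t c, ρ.output k i t c ∧ ∃ τ' > τ, ∃ o', (ρ.conf τ').phase i = .loop o' k t c := by
  have hinv := (h.invariant τ).2 i
  rw [hp] at hinv
  obtain ⟨s, hs⟩ := hinv
  obtain ⟨t, c, ht⟩ := (h.gca k).termination i s (Or.inl hi) hs
  refine ⟨t, c, ht, ?_⟩
  obtain ⟨τ', rfl, ha⟩ := ht
  have hd := (h.progress_of_decide ha).2
  -- Termination does not say when the call returns. The measure is `2 * k` at `τ` and `2 * k + 1`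
  -- after the return, so the return is not in the past.
  have hτ : τ < τ' + 1 := by
    by_contra! hle
    have := h.progress_mono (ρ.proc τ') hle
    simp only [hd] at this
    rw [Config.progress, hp] at this
    simp only [Phase.progress] at this
    omega
  refine ⟨τ' + 1, hτ, ?_⟩
  have hst := h.step τ'
  rw [ha] at hst
  generalize ρ.conf (τ' + 1) = γ' at *
  cases hst with
  | decide o => exact ⟨o, by simp [Config.setPhase]⟩

section Stuck

variable {Φ : OpInstance n O}

theorem op_of_not_completes (h : ρ.IsExecution) (hΦ : IsInstance ρ.toInfExec Φ)
    (hnc : ¬ Completes ρ.toInfExec Φ) {τ : ℕ} (hτ : Φ.time < τ) :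
    ((ρ.conf τ).phase Φ.proc).op? = some Φ.op ∧ (ρ.conf τ).cmd Φ.proc Φ.op = ρ.cmdOf Φ :=
  h.op_of_pending hΦ hτ fun _ hu _ _ hv => hnc (exists_first_response hu hv)

/-- From this control state the only possible step is the response, and a further step does come. -/
theorem not_returning (h : ρ.IsExecution) (hinf : InfinitelyManySteps ρ.toInfExec Φ.proc)
    (hnc : ¬ Completes ρ.toInfExec Φ) {τ : ℕ}
    (hτ : Φ.time < τ) (o : O) (s : Trace (commandObject A n)) :
    (ρ.conf τ).phase Φ.proc ≠ .returning o s := by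
  intro hp
  obtain ⟨τ', hle, hi, hp'⟩ := h.exists_next_step hinf τ
  rw [hp] at hp'
  have hst := h.step τ'
  rw [hi] at hst
  have hr : ∀ v, ρ.toInfExec τ' ≠ (Φ.proc, .res v) := fun v hv =>
    hnc (exists_first_response (hτ.trans_le hle) hv)
  unfold toInfExec at hr
  rw [hi] at hr
  generalize ρ.conf (τ' + 1) = γ' at *
  generalize ρ.act τ' = a at *
  cases hst with
  | respond o s v => exact hr v rfl
  | invoke | read | select | propose | work | decide | write => simp_all

/-- Each step in the collect phase either enters the loop or lowers `m`, the number of unread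
registers. -/
theorem exists_loop (h : ρ.IsExecution) (hinf : InfinitelyManySteps ρ.toInfExec Φ.proc)
    (hΦ : IsInstance ρ.toInfExec Φ) :
    ∃ τ > Φ.time, ∃ o r s c, (ρ.conf τ).phase Φ.proc = .loop o r s c := by
  classical
  have key : ∀ (m τ : ℕ) (o : O) (view : Fin n → Option (ℕ × Trace (commandObject A n))),
      Φ.time < τ → (ρ.conf τ).phase Φ.proc = .collect o view →
      (Finset.univ.filter fun j => view j = none).card = m →
      ∃ τ > Φ.time, ∃ o r s c, (ρ.conf τ).phase Φ.proc = .loop o r s c := by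
    intro m
    induction m using Nat.strong_induction_on with
    | _ m ih =>
      intro τ o view hτ hp hm
      obtain ⟨τ', hle, hi, hp'⟩ := h.exists_next_step hinf τ
      rw [hp] at hp'
      have hst := h.step τ'
      rw [hi] at hst
      have ih' := fun m' hm' => ih m' hm' (τ' + 1)
      have hτ' : Φ.time < τ' + 1 := by omega
      have hex : (∃ o r s c, (ρ.conf (τ' + 1)).phase Φ.proc = .loop o r s c) →
          ∃ τ > Φ.time, ∃ o r s c, (ρ.conf τ).phase Φ.proc = .loop o r s c :=
        fun hex => ⟨τ' + 1, hτ', hex⟩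
      generalize ρ.conf (τ' + 1) = γ' at *
      generalize ρ.act τ' = a at *
      cases hst with
      | read o' view' j hq hj =>
        rw [hp'] at hq
        obtain ⟨rfl, rfl⟩ := Phase.collect.inj hq
        refine ih' _ ?_ o _ hτ' (Function.update_self ..) rfl
        rw [← hm]
        refine Finset.card_lt_card (Finset.ssubset_iff.2 ⟨j, by simp, ?_⟩)
        intro k hk
        rw [Finset.mem_insert, Finset.mem_filter_univ] at hk
        rw [Finset.mem_filter_univ]
        rcases hk with rfl | hk
        · exact hj
        · by_cases hkj : k = j
          · exact hkj ▸ hj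
          · rwa [Function.update_of_ne hkj] at hk
      | select o' val j hq hj =>
        exact hex ⟨o', _, _, _, by simp only [Config.setPhase, Function.update_self]; rfl⟩
      | invoke | respond | propose | work | decide | write => simp_all
  exact key _ (Φ.time + 1) _ _ (Nat.lt_succ_self _) (h.phase_of_isInstance hΦ) rfl

/-- At the guard the next step is a call or a write. A write would lead to the excluded returning
state, so the guard holds and the call, once returned, leads back to the guard one round later. -/
theorem next_round (h : ρ.IsExecution) (hinf : InfinitelyManySteps ρ.toInfExec Φ.proc)
    (hΦ : IsInstance ρ.toInfExec Φ) (hnc : ¬ Completes ρ.toInfExec Φ) {τ : ℕ} (hτ : Φ.time < τ)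
    {o : O} {r : ℕ} {s : Trace (commandObject A n)} {c : Bool}
    (hp : (ρ.conf τ).phase Φ.proc = .loop o r s c) :
    (c = true → ρ.cmdOf Φ ∉ s.ops) ∧
      (∃ u, ρ.input (r + 1) Φ.proc u ∧ ρ.cmdOf Φ ∈ u.ops) ∧
      ∃ t d, ρ.output (r + 1) Φ.proc t d ∧
        ∃ τ' > Φ.time, ∃ o', (ρ.conf τ').phase Φ.proc = .loop o' (r + 1) t d := by
  obtain ⟨τ', hle, hi, hp'⟩ := h.exists_next_step hinf τ
  rw [hp] at hp'
  obtain ⟨ho, hcmd⟩ := h.op_of_not_completes hΦ hnc (hτ.trans_le hle)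
  have hst := h.step τ'
  rw [hi] at hst
  have hret := h.not_returning hinf hnc (τ := τ' + 1) (by omega)
  have hcall := fun o k => h.exists_output_of_calling hinf (τ := τ' + 1) (o := o) (k := k)
  have hin : ∀ k u, ρ.act τ' = .propose k u → ρ.input k Φ.proc u := fun k u ha => ⟨τ', hi, ha⟩
  have hlt : ∀ τ'' > τ' + 1, τ'' > Φ.time := fun τ'' hlt => by omega
  generalize ρ.conf (τ' + 1) = γ' at *
  generalize ρ.act τ' = a at *
  cases hst with
  | propose o' r' s' c' hq hg =>
    rw [hp'] at hq ho
    obtain ⟨rfl, rfl, rfl, rfl⟩ := Phase.loop.inj hq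
    obtain rfl : o = Φ.op := Option.some.inj ho
    rw [hcmd] at hg hin
    refine ⟨?_, ⟨_, hin _ _ rfl, mem_ops_extend _ _⟩, ?_⟩
    · rintro rfl
      simpa using hg
    · obtain ⟨t, d, h1, τ'', h2, h3⟩ :=
        hcall Φ.op (r + 1) (by simp [Config.setPhase])
      exact ⟨t, d, h1, τ'', hlt _ h2, h3⟩
  | write o' r' s' c' hq hg => exact absurd (by simp) (hret o' s')
  | invoke | respond | read | select | work | decide => simp_all

/-- From some round on, a participant that is stuck in an operation with infinitely many steps
takes part in every round, and never commits a trace with its command. -/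
theorem exists_rounds_of_not_completes (h : ρ.IsExecution)
    (hinf : InfinitelyManySteps ρ.toInfExec Φ.proc) (hΦ : IsInstance ρ.toInfExec Φ)
    (hnc : ¬ Completes ρ.toInfExec Φ) :
    ∃ K, ∀ k ≥ K, (∃ u, ρ.input k Φ.proc u ∧ ρ.cmdOf Φ ∈ u.ops) ∧
      ∃ t c, ρ.output k Φ.proc t c ∧ (c = true → ρ.cmdOf Φ ∉ t.ops) := by
  obtain ⟨τ, hτ, o, r, s, c, hp⟩ := h.exists_loop hinf hΦ
  have key : ∀ k ≥ r, ∃ τ > Φ.time, ∃ o s c, (ρ.conf τ).phase Φ.proc = .loop o k s c := by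
    intro k hk
    induction k, hk using Nat.le_induction with
    | base => exact ⟨τ, hτ, o, s, c, hp⟩
    | succ k hk ih =>
      obtain ⟨τ, hτ, o, s, c, hp⟩ := ih
      obtain ⟨-, -, t, d, -, τ', hτ', o', hp'⟩ := h.next_round hinf hΦ hnc hτ hp
      exact ⟨τ', hτ', o', t, d, hp'⟩
  refine ⟨r + 1, fun k hk => ?_⟩
  obtain ⟨k, rfl⟩ : ∃ k', k = k' + 1 := ⟨k - 1, by omega⟩
  obtain ⟨τ, hτ, o, s, c, hp⟩ := key k (by omega)
  obtain ⟨-, hin, t, d, hout, τ', hτ', o', hp'⟩ := h.next_round hinf hΦ hnc hτ hp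
  -- The second use of `next_round` is at the guard after the return: passing it again shows that
  -- `(t, d)` did not commit the command.
  exact ⟨hin, t, d, hout, (h.next_round hinf hΦ hnc hτ' hp').1⟩

end Stuck

/-! ### Eventual rounds -/

/-- Finitely many steps touch finitely many rounds; hence all calls and returns of late rounds
happen after any given time. -/
theorem exists_round_bound (ρ : Run A n) (T : ℕ) :
    ∃ K, ∀ τ < T, ∀ k, ((∃ s, ρ.act τ = .propose k s) ∨ ∃ t c, ρ.act τ = .decide k t c) →
      k < K := by
  induction T with
  | zero => exact ⟨0, fun τ hτ => absurd hτ (Nat.not_lt_zero τ)⟩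
  | succ T ih =>
    obtain ⟨K, hK⟩ := ih
    obtain ⟨K', hK'⟩ : ∃ K', ∀ k, ((∃ s, ρ.act T = .propose k s) ∨ ∃ t c, ρ.act T = .decide k t c) →
        k < K' := by
      cases ρ.act T with
      | propose k s => exact ⟨k + 1, by simp +contextual⟩
      | decide k t c => exact ⟨k + 1, by simp +contextual⟩
      | _ => exact ⟨0, by simp⟩
    refine ⟨max K K', fun τ hτ k hk => ?_⟩
    rcases Nat.lt_succ_iff_lt_or_eq.1 hτ with hτ | rfl
    · exact lt_max_of_lt_left (hK τ hτ k hk)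
    · exact lt_max_of_lt_right (hK' k hk)

theorem exists_no_input (ρ : Run A n) {i : Fin n} (hi : ¬ InfinitelyManySteps ρ.toInfExec i) :
    ∃ K, ∀ k ≥ K, ∀ s, ¬ ρ.input k i s := by
  unfold InfinitelyManySteps at hi
  push Not at hi
  obtain ⟨T, hT⟩ := hi
  obtain ⟨K, hK⟩ := exists_round_bound ρ T
  refine ⟨K, fun k hk s hs => ?_⟩
  obtain ⟨τ, hτ, ha⟩ := hs
  have hlt : τ < T := by
    by_contra! hle
    exact hT τ hle hτ
  have := hK τ hlt k (Or.inl ⟨s, ha⟩)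
  omega

theorem exists_infinitelyManySteps (α : InfExec n O R) : ∃ i, InfinitelyManySteps α i := by
  by_contra! hne
  unfold InfinitelyManySteps at hne
  push Not at hne
  choose T hT using hne
  exact hT (α (Finset.univ.sup T)).1 (Finset.univ.sup T) (Finset.le_sup (Finset.mem_univ _)) rfl

/-- If all participants with infinitely many steps are stuck, the inputs of the late rounds are
incompatible. -/
theorem not_compatible_of_stuck (h : ρ.IsExecution)
    (hstuck : ∀ i, InfinitelyManySteps ρ.toInfExec i → ¬ CompletesAll ρ.toInfExec i) :
    ∃ K, ∀ k ≥ K, ¬ Trace.Compatible {s | ∃ i, ρ.input k i s} := by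
  have hone : ∀ i, ∃ K, ∀ k ≥ K, (∀ s, ¬ ρ.input k i s) ∨
      ∃ x, (∃ u, ρ.input k i u ∧ x ∈ u.ops) ∧
        ∃ t c, ρ.output k i t c ∧ (c = true → x ∉ t.ops) := by
    intro i
    by_cases hi : InfinitelyManySteps ρ.toInfExec i
    · have := hstuck i hi
      unfold CompletesAll at this
      push Not at this
      obtain ⟨Φ, hΦ, rfl, hnc⟩ := this
      obtain ⟨K, hK⟩ := h.exists_rounds_of_not_completes hi hΦ hnc
      exact ⟨K, fun k hk => Or.inr ⟨_, hK k hk⟩⟩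
    · obtain ⟨K, hK⟩ := exists_no_input ρ hi
      exact ⟨K, fun k hk => Or.inl (hK k hk)⟩
  choose K hK using hone
  obtain ⟨i, hi⟩ := exists_infinitelyManySteps ρ.toInfExec
  obtain ⟨K', hK'⟩ : ∃ K', ∀ k ≥ K', ∃ u, ρ.input k i u := by
    have := hstuck i hi
    unfold CompletesAll at this
    push Not at this
    obtain ⟨Φ, hΦ, rfl, hnc⟩ := this
    obtain ⟨K, hK⟩ := h.exists_rounds_of_not_completes hi hΦ hnc
    exact ⟨K, fun k hk => (hK k hk).1.imp fun _ hu => hu.1⟩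
  refine ⟨max K' (Finset.univ.sup K), fun k hk hcomp => ?_⟩
  have hk' : ∀ j, k ≥ K j := fun j =>
    (Finset.le_sup (Finset.mem_univ j)).trans ((le_max_right _ _).trans hk)
  obtain ⟨u, hu⟩ := hK' k ((le_max_left _ _).trans hk)
  obtain ⟨j, s, t, hs, ht, hle⟩ := (h.gca k).commitment ⟨i, u, hu⟩ hcomp fun j s hs => by
    rcases hK j k (hk' j) with hno | ⟨x, -, t, c, ht, -⟩
    · exact absurd hs (hno s)
    · exact ⟨t, c, ht⟩
  rcases hK j k (hk' j) with hno | ⟨x, ⟨u, hu, hx⟩, t', c, ht', hc⟩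
  · exact hno s hs
  · obtain rfl := h.input_unique hu hs
    obtain ⟨rfl, rfl⟩ := h.output_unique ht' ht
    -- The committed trace extends the input of `j`, so it contains the command of `j`, which `j`
    -- never commits.
    exact hc rfl (Multiset.mem_of_le (Trace.ops_le_of_le hle) hx)

/-- If all participants with infinitely many steps are stuck, no participant responds from some
time on. -/
theorem exists_no_response (hstuck : ∀ i, InfinitelyManySteps ρ.toInfExec i →
    ¬ CompletesAll ρ.toInfExec i) :
    ∃ T, ∀ τ ≥ T, ∀ i v, ρ.toInfExec τ ≠ (i, .res v) := by
  have hone : ∀ i, ∃ T, ∀ τ ≥ T, ∀ v, ρ.toInfExec τ ≠ (i, .res v) := by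
    intro i
    by_cases hi : InfinitelyManySteps ρ.toInfExec i
    · have := hstuck i hi
      unfold CompletesAll at this
      push Not at this
      obtain ⟨Φ, hΦ, rfl, hnc⟩ := this
      exact ⟨Φ.time + 1, fun τ hτ v hv => hnc (exists_first_response hτ hv)⟩
    · unfold InfinitelyManySteps at hi
      push Not at hi
      obtain ⟨T, hT⟩ := hi
      exact ⟨T, fun τ hτ v hv => hT τ hτ (congrArg Prod.fst hv)⟩
  choose T hT using hone
  exact ⟨Finset.univ.sup T, fun τ hτ i => hT i τ ((Finset.le_sup (Finset.mem_univ i)).trans hτ)⟩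

/-- If all participants with infinitely many steps are stuck and the execution is eventually
conflict-free, the inputs of the late rounds are compatible. -/
theorem compatible_of_eventuallyConflictFree (h : ρ.IsExecution)
    (hstuck : ∀ i, InfinitelyManySteps ρ.toInfExec i → ¬ CompletesAll ρ.toInfExec i)
    (hcf : EventuallyConflictFree A ρ.toInfExec) :
    ∃ K, ∀ k ≥ K, Trace.Compatible {s | ∃ i, ρ.input k i s} := by
  obtain ⟨T, hT⟩ := exists_no_response hstuck
  obtain ⟨K, hK⟩ := exists_round_bound ρ T
  refine ⟨K, fun k hk => ?_⟩
  -- `w` is committed in the last committing round before `k`, or empty if there is none.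
  obtain ⟨w, hw, hmax⟩ : ∃ w, (∀ i s, ρ.input k i s → w ≤ s) ∧
      ∀ r < k, ∀ i t, ρ.output r i t true → t ≤ w := by
    by_cases hex : ∃ r < k, ∃ i t, ρ.output r i t true
    · have hb : BddAbove {r | r < k ∧ ∃ i t, ρ.output r i t true} := ⟨k, fun r hr => hr.1.le⟩
      obtain ⟨hr, i, w, hw⟩ := Nat.sSup_mem (s := {r | r < k ∧ ∃ i t, ρ.output r i t true})
        (hex.imp fun _ hr => hr) hb
      refine ⟨w, fun j s hs => ?_, fun r hr j t ht => ?_⟩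
      · obtain ⟨k, rfl⟩ : ∃ k', k = k' + 1 := ⟨k - 1, by omega⟩
        exact (h.committed_le hw (Nat.le_of_lt_succ hr)).2 j s hs
      · exact (h.committed_le ht (le_csSup hb ⟨hr, j, t, ht⟩)).1 i w true hw
    · exact ⟨1, fun _ s _ => Trace.one_le s, fun r hr i t ht => absurd ⟨r, hr, i, t, ht⟩ hex⟩
  -- A completed instance responded before `T`, so its command was committed in a round below `K ≤
  -- k` and lies in `w`.
  have hpend : ∀ Φ, IsInstance ρ.toInfExec Φ → ρ.cmdOf Φ ∉ w.ops → ¬ Completes ρ.toInfExec Φ := by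
    rintro Φ hΦ hΦw ⟨t, ht⟩
    obtain ⟨r, s, hs, τ, hτ, hi, ha⟩ := h.exists_committed_of_respondsAt hΦ ht
    have htT : t < T := by
      by_contra! hle
      obtain ⟨v, hv⟩ := ht.2.1
      exact hT t hle _ v hv
    have hr := hK τ (hτ.trans htT) r (Or.inr ⟨s, true, ha⟩)
    exact hΦw (Multiset.mem_of_le
      (Trace.ops_le_of_le (hmax r (hr.trans_le hk) _ s ⟨τ, hi, ha⟩)) hs)
  obtain ⟨T', hT'⟩ := hcf
  refine Trace.compatible_of_not_conflict (w := w) (h.finite_inputs k) ?_ ?_ ?_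
  · rintro s ⟨i, hs⟩
    exact hw i s hs
  · rintro s ⟨i, hs⟩
    exact (h.exists_cmdOf_eq hs).1
  · rintro s ⟨i, hs⟩ u ⟨j, hu⟩ a ha b hb haw hbw hab
    obtain ⟨Φ, hΦ, rfl⟩ := (h.exists_cmdOf_eq hs).2 a ha
    obtain ⟨Ψ, hΨ, rfl⟩ := (h.exists_cmdOf_eq hu).2 b hb
    have hΦ' := hpend Φ hΦ haw
    have hΨ' := hpend Ψ hΨ hbw
    -- Instances that never complete meet every suffix and are concurrent. Conflict of commands is
    -- by definition conflict of their operations.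
    exact hT' Φ Ψ hΦ hΨ (fun he => hab (congrArg ρ.cmdOf he))
      (fun ⟨t, ht, _⟩ => hΦ' ⟨t, ht⟩) (fun ⟨t, ht, _⟩ => hΨ' ⟨t, ht⟩)
      ⟨fun ⟨t, ht, _⟩ => hΦ' ⟨t, ht⟩, fun ⟨t, ht, _⟩ => hΨ' ⟨t, ht⟩⟩

/-! ### The two progress properties -/

theorem completes_of_eventuallyStepContentionFree (h : ρ.IsExecution) {Φ : OpInstance n O}
    (hΦ : IsInstance ρ.toInfExec Φ) (hsolo : EventuallyStepContentionFree ρ.toInfExec Φ) :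
    Completes ρ.toInfExec Φ := by
  by_contra hnc
  obtain ⟨T, hT⟩ := hsolo.resolve_left hnc
  -- A process with infinitely many steps moves after `T`, so it is the caller of `Φ`, which leaves
  -- `Φ` pending.
  obtain ⟨K, hK⟩ := h.not_compatible_of_stuck fun i hi hall => by
    obtain ⟨τ, hτ, hp⟩ := hi T
    exact hnc (hall Φ hΦ ((hT τ hτ).1.symm.trans hp))
  obtain ⟨K', hK'⟩ := exists_round_bound ρ T
  refine hK (max K K') (le_max_left _ _) ?_
  have hsub : {s | ∃ i, ρ.input (max K K') i s}.Subsingleton := by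
    have hproc : ∀ i s, ρ.input (max K K') i s → i = Φ.proc := by
      rintro i s ⟨τ, rfl, ha⟩
      refine (hT τ ?_).1
      by_contra! hlt
      have := hK' τ hlt _ (Or.inl ⟨s, ha⟩)
      omega
    rintro s ⟨i, hs⟩ u ⟨j, hu⟩
    obtain rfl := hproc i s hs
    obtain rfl := hproc j u hu
    exact h.input_unique hs hu
  rcases hsub.eq_empty_or_singleton with he | ⟨s, he⟩
  · exact ⟨1, by simp [he]⟩
  · exact ⟨s, by simp [he]⟩

theorem exists_completesAll (h : ρ.IsExecution) (hcf : EventuallyConflictFree A ρ.toInfExec) :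
    ∃ i, InfinitelyManySteps ρ.toInfExec i ∧ CompletesAll ρ.toInfExec i := by
  by_contra! hstuck
  obtain ⟨K, hK⟩ := h.not_compatible_of_stuck hstuck
  obtain ⟨K', hK'⟩ := h.compatible_of_eventuallyConflictFree hstuck hcf
  exact hK _ (le_max_left K K') (hK' _ (le_max_right K K'))

end IsExecution
end Run
end Instances

end ConflictFree

theorem mainTheorem5 {Q O R : Type*} (A : ConflictFree.SeqObject Q O R) (n : ℕ) :
    ConflictFree.WeaklyConflictFree A (ConflictFree.ucExecutions A n) ∧
    ∀ α ∈ ConflictFree.ucExecutions A n, ConflictFree.EventuallyConflictFree A α →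
      ∃ i : Fin n, ConflictFree.InfinitelyManySteps α i ∧ ConflictFree.CompletesAll α i := by
  refine ⟨⟨?_, ?_⟩, ?_⟩
  · rintro _ ⟨ρ, h, rfl⟩ Φ hΦ - hsolo
    exact h.completes_of_eventuallyStepContentionFree hΦ hsolo
  · rintro _ ⟨ρ, h, rfl⟩ hcf
    obtain ⟨i, -, hall⟩ := h.exists_completesAll hcf
    exact ⟨i, Or.inr hall, hall⟩
  · rintro _ ⟨ρ, h, rfl⟩ hcf
    exact h.exists_completesAll hcf
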